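/- Let $B>0$ and consider a $K$-armed bandit ($K\ge 1$) in an oblivious environment: a possibly random sequence of loss vectors $\ell_1,\ell_2,\dots\in[0,B]^K$ that does not depend on the actions of the learner. In round $t=1,2,\dots$, Tsallis-INF with learning rates $\eta_t=\frac{2}{B\sqrt t}$ computes $$p_t=\arg\min_{p\in\Delta^{K-1}}\Big\{\langle p,\tilde C_{t-1}\rangle-\sum_{i=1}^K\frac{4\sqrt{p_i}-2p_i}{\eta_t}\Big\},\qquad \tilde C_{t-1,i}=\sum_{s=1}^{t-1}\frac{\ell_{s,i}}{p_{s,i}}\mathbf 1[J_s=i],$$ where $\Delta^{K-1}$ is the probability simplex, draws the arm $J_t\sim p_t$, and observes and suffers the loss $\ell_{t,J_t}$. Let $R_T=\mathbb E\big[\sum_{t=1}^T\ell_{t,J_t}\big]-\min_i\mathbb E\big[\sum_{t=1}^T\ell_{t,i}\big]$ be its pseudo-regret. Then, for every $T\ge 1$, $$R_T\le 4B\sqrt{KT}+1 .$$ Furthermore, suppose that the environment is in the stochastically constrained adversarial regime: there are constants $\Delta_{i,j}$, the gaps in units of the loss range $B$, such that for all $t,i,j$ the expectation of $\ell_{t,i}-\ell_{t,j}$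 conditionally on $\ell_1,\dots,\ell_{t-1}$ equals $B\,\Delta_{i,j}$ (for instance, the loss vectors are independent across rounds and $\mathbb E[\ell_{t,i}-\ell_{t,j}]=B\,\Delta_{i,j}$). Let $\Delta_i=\Delta_{i,1}-\min_j\Delta_{j,1}$, and suppose that there is a unique best arm $i^*$, that is, $\Delta_{i^*}=0$ and $\Delta_i>0$ for all $i\ne i^*$. Then, for every $T\ge1$, also $$R_T\le 21B(\ln T+1)\sum_{i\ne i^*}\frac1{\Delta_i}+8\sqrt B+2 .$$ -/

import Mathlib

open MeasureTheory

namespace Bandit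

noncomputable section

variable {Ω : Type*} {K : ℕ}

/-- The function of `p` minimised by Tsallis-INF with learning rate `η` and cumulative
loss estimates `C`: `⟨p, C⟩ - ∑ i, (4 √p_i - 2 p_i) / η`. -/
def tsallisObjective (η : ℝ) (C p : Fin K → ℝ) : ℝ :=
  ∑ i, p i * C i - ∑ i, (4 * √(p i) - 2 * p i) / η

/-- `p` is the minimiser of the Tsallis-INF objective over the probability simplex. -/
def IsTsallisWeights (η : ℝ) (C p : Fin K → ℝ) : Prop :=
  p ∈ stdSimplex ℝ (Fin K) ∧ IsMinOn (tsallisObjective η C) (stdSimplex ℝ (Fin K)) p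

/-- The importance-weighted estimate, after round `t`, of the loss of arm `i` in round `t`.
Here `ℓ t ω i` is the loss of arm `i` in round `t`, `J t ω` is the arm played in round `t` and
`p t ω` is the distribution from which it was drawn. -/
def lossEstimate (ℓ : ℕ → Ω → Fin K → ℝ) (J : ℕ → Ω → Fin K) (p : ℕ → Ω → Fin K → ℝ)
    (t : ℕ) (ω : Ω) (i : Fin K) : ℝ :=
  if J t ω = i then ℓ t ω i / p t ω i else 0

/-- The cumulative loss estimates available before round `t`, that is, the sum of the estimates
of rounds `1, …, t - 1`. -/
def cumLossEstimate (ℓ : ℕ → Ω → Fin K → ℝ) (J : ℕ → Ω → Fin K) (p : ℕ → Ω → Fin K → ℝ)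
    (t : ℕ) (ω : Ω) (i : Fin K) : ℝ :=
  ∑ s ∈ Finset.Ico 1 t, lossEstimate ℓ J p s ω i

/-- The σ-algebra generated by the loss vectors of all rounds `1, 2, …`. -/
@[reducible] def allLosses (ℓ : ℕ → Ω → Fin K → ℝ) : MeasurableSpace Ω :=
  ⨆ (s : ℕ) (_ : 1 ≤ s), MeasurableSpace.comap (ℓ s) inferInstance

/-- The σ-algebra generated by the loss vectors of rounds `1, …, t - 1`. -/
@[reducible] def pastLosses (ℓ : ℕ → Ω → Fin K → ℝ) (t : ℕ) : MeasurableSpace Ω :=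
  ⨆ s ∈ Finset.Ico 1 t, MeasurableSpace.comap (ℓ s) inferInstance

/-- The σ-algebra generated by the arms played in rounds `1, …, t - 1`. -/
@[reducible] def pastArms (J : ℕ → Ω → Fin K) (t : ℕ) : MeasurableSpace Ω :=
  ⨆ s ∈ Finset.Ico 1 t, MeasurableSpace.comap (J s) inferInstance

variable [MeasurableSpace Ω]

/-- A loss sequence with (measurable, possibly random) loss vectors in `[0, B] ^ K`. -/
structure IsLossSequence (B : ℝ) (ℓ : ℕ → Ω → Fin K → ℝ) : Prop where
  measurable : ∀ t, 1 ≤ t → Measurable (ℓ t)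
  mem_Icc : ∀ t, 1 ≤ t → ∀ ω i, ℓ t ω i ∈ Set.Icc 0 B

/-- The arms `J 1, J 2, …` are those played by Tsallis-INF with learning rates `η 1, η 2, …`
against the oblivious loss sequence `ℓ`, and `p t` is the sampling distribution in round `t`.
The environment is oblivious: conditionally on the past arms and on the whole loss sequence
(future losses included), the arm of round `t` is drawn from `p t`, which the algorithm computes
from the losses that it has observed. -/
structure IsTsallisINF (μ : Measure Ω) (η : ℕ → ℝ) (ℓ : ℕ → Ω → Fin K → ℝ)
    (J : ℕ → Ω → Fin K) (p : ℕ → Ω → Fin K → ℝ) : Prop where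
  measurable : ∀ t, 1 ≤ t → Measurable (J t)
  weights : ∀ t, 1 ≤ t → ∀ ω, IsTsallisWeights (η t) (cumLossEstimate ℓ J p t ω) (p t ω)
  sampling : ∀ t, 1 ≤ t → ∀ i,
    μ[Set.indicator {ω | J t ω = i} (fun _ => (1 : ℝ)) | allLosses ℓ ⊔ pastArms J t]
      =ᵐ[μ] fun ω => p t ω i

/-- The pseudo-regret after `T` rounds,
`𝔼[∑ t, ℓ t (J t)] - min_i 𝔼[∑ t, ℓ t i]`. -/
def pseudoRegret (μ : Measure Ω) (ℓ : ℕ → Ω → Fin K → ℝ) (J : ℕ → Ω → Fin K) (T : ℕ) : ℝ :=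
  ∫ ω, ∑ t ∈ Finset.Icc 1 T, ℓ t ω (J t ω) ∂μ
    - ⨅ i, ∫ ω, ∑ t ∈ Finset.Icc 1 T, ℓ t ω i ∂μ

/-- The stochastically constrained adversarial regime for losses in `[0, B] ^ K`: the
distribution of the loss vector may change from round to round, but, whatever the past losses,
the differences of the expected losses of the arms are fixed, `𝔼[ℓ t i - ℓ t j] = B * D i j`.
The numbers `D i j` are measured in units of the range `B`. -/
def IsStochConstrained (μ : Measure Ω) (B : ℝ) (ℓ : ℕ → Ω → Fin K → ℝ)
    (D : Fin K → Fin K → ℝ) : Prop :=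
  ∀ t, 1 ≤ t → ∀ i j,
    μ[fun ω => ℓ t ω i - ℓ t ω j | pastLosses ℓ t] =ᵐ[μ] fun _ => B * D i j

/-- The suboptimality gap of arm `i`, `D i 1 - min_j D j 1` (the first arm is `0 : Fin K`). -/
def gap [NeZero K] (D : Fin K → Fin K → ℝ) (i : Fin K) : ℝ :=
  D i 0 - ⨅ j, D j 0

/-- `a` is the unique best arm. -/
def IsUniqueBestArm [NeZero K] (D : Fin K → Fin K → ℝ) (a : Fin K) : Prop :=
  gap D a = 0 ∧ ∀ i, i ≠ a → 0 < gap D i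

end

end Bandit

/-! On the simplex the linear part of the regulariser is constant, so the algorithm follows the
leader regularised by $-\beta_t\sum_i\sqrt{p_i}$ with $\beta_t=4/\eta_t=2B\sqrt t$. Against a fixed
arm its regret on the loss estimates is at most a sum of stability terms and penalties
$(\beta_t-\beta_{t-1})(\sum_i\sqrt{p_{t,i}}-1)$ (`ftrl_regret_le`). The estimates are unbiased given
the past arms and all losses, so taking expectations bounds the true regret
(`IsTsallisINF.regret_le`).

Adversarial bound: when arm $j$ is played, the stability term is at most $\frac{B}{\sqrt
t}\sqrt{p_j}/p_j$. Averaged over $j\sim p_t$ this is $\frac{B}{\sqrt t}\sum_j\sqrt{p_j}\le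
B\sqrt{K/t}$. Stability and penalty each sum to at most $2B\sqrt{KT}$.

Stochastic bound: every term must be expressed through the arms other than the best arm $a$. The
penalty already allows this, since $\sqrt{p_a}\le1$. For stability when $a$ itself is played,
$p_a-w_a=\sum_{i\ne a}(w_i-p_i)$ turns a loss on $a$ into an equal gain on all other arms
(`tsallis_stability_le_sum_ne`). Hence $R\le U=\sum_t\frac{9B}{2\sqrt t}\sum_{i\ne a}\mathbb
E\sqrt{p_{t,i}}$, while the gaps give $R=\sum_t\sum_{i\ne a}B\Delta_i\mathbb E\,p_{t,i}$. Writing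
$R\le 2U-R$ and maximising each summand over $p_{t,i}$ leaves $\frac{81B}{4t\Delta_i}$, a harmonic
sum. -/

namespace Bandit

/-- The Bregman divergence of `w ↦ -4 ∑ i, √(w i)`. -/
noncomputable def tsallisDiv {K : ℕ} (w p : Fin K → ℝ) : ℝ :=
  ∑ i, 2 * (√(w i) - √(p i)) ^ 2 / √(p i)

/-! ### The Tsallis-INF minimiser: positivity, optimality, uniqueness, continuity -/

section Deterministic

variable {K : ℕ} {η : ℝ} {C p w : Fin K → ℝ}

lemma tsallisObjective_eq (hp : p ∈ stdSimplex ℝ (Fin K)) :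
    tsallisObjective η C p = ∑ i, p i * C i - 4 / η * ∑ i, √(p i) + 2 / η := by
  have h : ∑ i, (4 * √(p i) - 2 * p i) / η = 4 / η * ∑ i, √(p i) - 2 / η * ∑ i, p i := by
    rw [Finset.mul_sum, Finset.mul_sum, ← Finset.sum_sub_distrib]
    exact Finset.sum_congr rfl fun i _ => by ring
  rw [tsallisObjective, h, hp.2]
  ring

lemma IsTsallisWeights.le (h : IsTsallisWeights η C p) (hw : w ∈ stdSimplex ℝ (Fin K)) :
    ∑ i, p i * C i - 4 / η * ∑ i, √(p i) ≤ ∑ i, w i * C i - 4 / η * ∑ i, √(w i) := by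
  have h1 := h.2 hw
  simp only [Set.mem_ofPred_eq, tsallisObjective_eq h.1, tsallisObjective_eq hw] at h1
  linarith

lemma segment_mem_stdSimplex (hp : p ∈ stdSimplex ℝ (Fin K)) (hw : w ∈ stdSimplex ℝ (Fin K))
    {ε : ℝ} (h0 : 0 ≤ ε) (h1 : ε ≤ 1) :
    (fun i => p i + ε * (w i - p i)) ∈ stdSimplex ℝ (Fin K) := by
  have := convex_stdSimplex ℝ (Fin K) hp hw (sub_nonneg.2 h1) h0 (by ring)
  convert this using 1
  ext i
  simp only [Pi.add_apply, Pi.smul_apply, smul_eq_mul]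
  ring

lemma sum_segment (p w C : Fin K → ℝ) (ε : ℝ) :
    ∑ i, (p i + ε * (w i - p i)) * C i = ∑ i, p i * C i + ε * ∑ i, (w i - p i) * C i := by
  rw [Finset.mul_sum, ← Finset.sum_add_distrib]
  exact Finset.sum_congr rfl fun i _ => by ring

lemma le_one_of_mem_stdSimplex (hp : p ∈ stdSimplex ℝ (Fin K)) (i : Fin K) : p i ≤ 1 := by
  rw [← hp.2]
  exact Finset.single_le_sum (fun j _ => hp.1 j) (Finset.mem_univ i)

lemma IsTsallisWeights.pos (h : IsTsallisWeights η C p) (hη : 0 < η) (i : Fin K) : 0 < p i := by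
  by_contra hi
  have hi : p i = 0 := le_antisymm (not_lt.1 hi) (h.1.1 i)
  have hK : (0 : ℝ) < K := by
    have := i.pos
    exact_mod_cast this
  have hu : (fun _ => 1 / (K : ℝ)) ∈ stdSimplex ℝ (Fin K) :=
    ⟨fun _ => by positivity, by simp [hK.ne']⟩
  set M : ℝ := ∑ j, (1 / (K : ℝ) - p j) * C j + 4 / η * ∑ j, √(p j) with hM
  set c : ℝ := 4 / η * √(1 / (K : ℝ)) with hc
  have hc0 : 0 < c := by positivity
  -- A step of length $s^2$ towards the uniform distribution gains order $s$ from the square root at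
  -- the vanishing coordinate, but costs only order $s^2$ elsewhere.
  have key : ∀ s : ℝ, 0 < s → s ≤ 1 → c ≤ s * M := by
    intro s hs0 hs1
    have hs2 : s ^ 2 ≤ 1 := by nlinarith
    have h1 := h.le (segment_mem_stdSimplex h.1 hu (sq_nonneg s) hs2)
    rw [sum_segment] at h1
    have h2 : (1 - s ^ 2) * ∑ j, √(p j) + s * √(1 / (K : ℝ))
        ≤ ∑ j, √(p j + s ^ 2 * (1 / (K : ℝ) - p j)) := by
      have h3 : ∀ j, (1 - s ^ 2) * √(p j) + (if j = i then s * √(1 / (K : ℝ)) else 0)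
          ≤ √(p j + s ^ 2 * (1 / (K : ℝ) - p j)) := by
        intro j
        split_ifs with hj
        · subst hj
          rw [hi]
          simp only [Real.sqrt_zero, mul_zero, zero_add, sub_zero]
          rw [Real.sqrt_mul (sq_nonneg s), Real.sqrt_sq hs0.le]
        · rw [add_zero]
          apply Real.le_sqrt_of_sq_le
          rw [mul_pow, Real.sq_sqrt (h.1.1 j)]
          have : (0 : ℝ) ≤ s ^ 2 * (1 / (K : ℝ)) := by positivity
          nlinarith [mul_nonneg (mul_nonneg (sq_nonneg s) (sub_nonneg.2 hs2)) (h.1.1 j)]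
      calc _ = ∑ j, ((1 - s ^ 2) * √(p j) + (if j = i then s * √(1 / (K : ℝ)) else 0)) := by
            rw [Finset.sum_add_distrib, ← Finset.mul_sum]; simp
        _ ≤ _ := Finset.sum_le_sum fun j _ => h3 j
    have h4 := mul_le_mul_of_nonneg_left h2 (by positivity : 0 ≤ 4 / η)
    have h5 : s * c ≤ s * (s * M) := by
      rw [hc, hM]
      nlinarith
    exact le_of_mul_le_mul_left h5 hs0
  have hd : 0 < c + |M| := by positivity
  have h1 := key (c / (c + |M|)) (by positivity) ((div_le_one hd).2 (by linarith [abs_nonneg M]))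
  have h2 : c / (c + |M|) * M ≤ c / (c + |M|) * |M| :=
    mul_le_mul_of_nonneg_left (le_abs_self M) (by positivity)
  have h3 : c / (c + |M|) * |M| < c := by
    rw [div_mul_eq_mul_div, div_lt_iff₀ hd]
    nlinarith
  linarith

/-- A Taylor bound valid for all $y\ge0$, not just near $x$: in terms of the square roots, the error
is an explicit nonnegative fraction. -/
lemma sqrt_add_lower {x y : ℝ} (hx : 0 < x) (hy : 0 ≤ y) :
    √x + (y - x) / (2 * √x) - (y - x) ^ 2 / (2 * x * √x) ≤ √y := by
  obtain ⟨a, ha, rfl⟩ : ∃ a, 0 < a ∧ x = a ^ 2 := ⟨√x, Real.sqrt_pos.2 hx, (Real.sq_sqrt hx.le).symm⟩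
  obtain ⟨b, hb, rfl⟩ : ∃ b, 0 ≤ b ∧ y = b ^ 2 := ⟨√y, Real.sqrt_nonneg y, (Real.sq_sqrt hy).symm⟩
  rw [Real.sqrt_sq ha.le, Real.sqrt_sq hb]
  have : b - (a + (b ^ 2 - a ^ 2) / (2 * a) - (b ^ 2 - a ^ 2) ^ 2 / (2 * a ^ 2 * a))
      = (b - a) ^ 2 * ((b + a) ^ 2 - a ^ 2) / (2 * a ^ 3) := by
    field_simp
    ring
  have h2 : 0 ≤ (b - a) ^ 2 * ((b + a) ^ 2 - a ^ 2) / (2 * a ^ 3) := by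
    apply div_nonneg (mul_nonneg (sq_nonneg _) (by nlinarith)) (by positivity)
  linarith

/-- First-order optimality without derivatives: moving by $\varepsilon$ towards $w$ changes the
objective by at most $\varepsilon(L+\varepsilon M)$, which forces $L\ge0$. -/
lemma IsTsallisWeights.variational (h : IsTsallisWeights η C p) (hη : 0 < η)
    (hw : w ∈ stdSimplex ℝ (Fin K)) :
    2 / η * ∑ i, (w i - p i) / √(p i) ≤ ∑ i, (w i - p i) * C i := by
  set L : ℝ := ∑ i, (w i - p i) * C i - 2 / η * ∑ i, (w i - p i) / √(p i) with hL
  set M : ℝ := 4 / η * ∑ i, (w i - p i) ^ 2 / (2 * p i * √(p i)) with hM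
  have key : ∀ ε : ℝ, 0 < ε → ε ≤ 1 → 0 ≤ L + ε * M := by
    intro ε h0 h1
    have h2 := h.le (segment_mem_stdSimplex h.1 hw h0.le h1)
    rw [sum_segment] at h2
    have h3 : ∑ i, √(p i) + ε / 2 * ∑ i, (w i - p i) / √(p i)
        - ε ^ 2 * ∑ i, (w i - p i) ^ 2 / (2 * p i * √(p i))
        ≤ ∑ i, √(p i + ε * (w i - p i)) := by
      rw [Finset.mul_sum, Finset.mul_sum, ← Finset.sum_add_distrib, ← Finset.sum_sub_distrib]
      refine Finset.sum_le_sum fun i _ => ?_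
      have hi := h.pos hη i
      have := sqrt_add_lower hi ((segment_mem_stdSimplex h.1 hw h0.le h1).1 i)
      refine le_trans (le_of_eq ?_) this
      have hs : 0 < √(p i) := Real.sqrt_pos.2 hi
      field_simp
      ring
    have h4 := mul_le_mul_of_nonneg_left h3 (by positivity : 0 ≤ 4 / η)
    have h5 : 0 ≤ ε * (L + ε * M) := by
      rw [hL, hM]
      have e : 4 / η = 2 * (2 / η) := by ring
      rw [e] at h2 h4 ⊢
      nlinarith
    exact nonneg_of_mul_nonneg_right h5 h0
  have : 0 ≤ L := by
    by_contra hneg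
    push Not at hneg
    have hd : 0 < |L| + |M| := by have := abs_pos.2 hneg.ne; positivity
    -- This $\varepsilon$ is small enough that $\varepsilon M\le|L|/2$, so a negative $L$ would
    -- dominate.
    have h1 := key (|L| / (2 * (|L| + |M|))) (by have := abs_pos.2 hneg.ne; positivity)
      ((div_le_one (by positivity)).2 (by linarith [abs_nonneg M, abs_nonneg L]))
    have h2 : |L| / (2 * (|L| + |M|)) * M ≤ |L| / 2 := by
      calc _ ≤ |L| / (2 * (|L| + |M|)) * (|L| + |M|) :=
            mul_le_mul_of_nonneg_left (by linarith [le_abs_self M, abs_nonneg L]) (by positivity)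
        _ = _ := by field_simp
    rw [abs_of_neg hneg] at h2
    rw [abs_of_neg hneg] at h1
    linarith
  linarith

/-- The objective grows away from its minimiser at least like the Bregman divergence. -/
lemma IsTsallisWeights.add_div_le (h : IsTsallisWeights η C p) (hη : 0 < η)
    (hw : w ∈ stdSimplex ℝ (Fin K)) :
    ∑ i, p i * C i - 4 / η * ∑ i, √(p i) + tsallisDiv w p / η
      ≤ ∑ i, w i * C i - 4 / η * ∑ i, √(w i) := by
  have h1 := h.variational hη hw
  have h2 : tsallisDiv w p / η
      = 4 / η * ∑ i, √(p i) - 4 / η * ∑ i, √(w i) + 2 / η * ∑ i, (w i - p i) / √(p i) := by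
    rw [tsallisDiv, Finset.sum_div, Finset.mul_sum, Finset.mul_sum, Finset.mul_sum,
      ← Finset.sum_sub_distrib, ← Finset.sum_add_distrib]
    refine Finset.sum_congr rfl fun i _ => ?_
    have hs : 0 < √(p i) := Real.sqrt_pos.2 (h.pos hη i)
    have e1 : p i = √(p i) ^ 2 := (Real.sq_sqrt (h.1.1 i)).symm
    have e2 : w i = √(w i) ^ 2 := (Real.sq_sqrt (hw.1 i)).symm
    have e3 : (w i - p i) / √(p i) = (√(w i) ^ 2 - √(p i) ^ 2) / √(p i) := by rw [← e1, ← e2]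
    rw [e3]
    field_simp
    ring
  have h3 : ∑ i, (w i - p i) * C i = ∑ i, w i * C i - ∑ i, p i * C i := by
    rw [← Finset.sum_sub_distrib]
    exact Finset.sum_congr rfl fun i _ => by ring
  linarith

lemma sum_sqrt_le (hp : p ∈ stdSimplex ℝ (Fin K)) : ∑ i, √(p i) ≤ √(K : ℝ) := by
  apply Real.le_sqrt_of_sq_le
  have := sq_sum_le_card_mul_sum_sq (s := (Finset.univ : Finset (Fin K))) (f := fun i => √(p i))
  simp only [Real.sq_sqrt (hp.1 _), hp.2, Finset.card_univ, Fintype.card_fin, mul_one] at this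
  exact this

/-- Optimality tested against the vertex of arm $i$. Bounded estimates thus keep the weights away
from zero. -/
lemma IsTsallisWeights.inv_sqrt_le (h : IsTsallisWeights η C p) (hη : 0 < η)
    (hC : ∀ i, 0 ≤ C i) (i : Fin K) : 1 / √(p i) ≤ √(K : ℝ) + η / 2 * C i := by
  have h1 := h.variational hη (single_mem_stdSimplex ℝ i)
  have h2 : ∑ j, ((Pi.single i 1 : Fin K → ℝ) j - p j) / √(p j) = 1 / √(p i) - ∑ j, √(p j) := by
    simp only [sub_div, Finset.sum_sub_distrib, Real.div_sqrt]
    congr 1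
    simp [Pi.single_apply, ite_div]
  have h3 : ∑ j, ((Pi.single i 1 : Fin K → ℝ) j - p j) * C j = C i - ∑ j, p j * C j := by
    simp only [sub_mul, Finset.sum_sub_distrib]
    simp [Pi.single_apply]
  rw [h2, h3] at h1
  have h4 : 0 ≤ ∑ j, p j * C j := Finset.sum_nonneg fun j _ => mul_nonneg (h.1.1 j) (hC j)
  have h5 := sum_sqrt_le h.1
  have h6 : 1 / √(p i) - ∑ j, √(p j) ≤ η / 2 * C i := by
    have := mul_le_mul_of_nonneg_left (h1.trans (sub_le_self _ h4)) (by positivity : 0 ≤ η / 2)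
    have e : η / 2 * (2 / η * (1 / √(p i) - ∑ j, √(p j))) = 1 / √(p i) - ∑ j, √(p j) := by
      field_simp
    linarith
  linarith

lemma half_sq_le_tsallisDiv (hp : p ∈ stdSimplex ℝ (Fin K)) (hw : w ∈ stdSimplex ℝ (Fin K))
    (hpos : ∀ i, 0 < p i) : ∑ i, (w i - p i) ^ 2 / 2 ≤ tsallisDiv w p := by
  refine Finset.sum_le_sum fun i _ => ?_
  have hs : 0 < √(p i) := Real.sqrt_pos.2 (hpos i)
  have hs1 : √(p i) ≤ 1 := Real.sqrt_le_one.2 (le_one_of_mem_stdSimplex hp i)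
  have ht1 : √(w i) ≤ 1 := Real.sqrt_le_one.2 (le_one_of_mem_stdSimplex hw i)
  have ht := Real.sqrt_nonneg (w i)
  have e : (w i - p i) ^ 2 = (√(w i) - √(p i)) ^ 2 * (√(w i) + √(p i)) ^ 2 := by
    rw [← mul_pow, mul_comm, ← sq_sub_sq, Real.sq_sqrt (hp.1 i), Real.sq_sqrt (hw.1 i)]
  rw [e, le_div_iff₀ hs]
  have h4 : (√(w i) + √(p i)) ^ 2 ≤ 4 := by nlinarith
  have h5 : (√(w i) - √(p i)) ^ 2 * (√(w i) + √(p i)) ^ 2 ≤ (√(w i) - √(p i)) ^ 2 * 4 :=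
    mul_le_mul_of_nonneg_left h4 (sq_nonneg _)
  have h6 : 0 ≤ (√(w i) - √(p i)) ^ 2 * (√(w i) + √(p i)) ^ 2 / 2 := by positivity
  nlinarith [mul_le_mul_of_nonneg_left hs1 h6]

/-- Strong convexity: adding the growth inequalities of the two minimisers, each tested at the
other, cancels the regularisers. The case $C'=C$ gives uniqueness, and the general case continuity
in $C$. -/
lemma IsTsallisWeights.sum_sq_le {C' p' : Fin K → ℝ} (h : IsTsallisWeights η C p)
    (h' : IsTsallisWeights η C' p') (hη : 0 < η) :
    ∑ i, (p' i - p i) ^ 2 ≤ η * ∑ i, |C' i - C i| := by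
  have h1 := h.add_div_le hη h'.1
  have h2 := h'.add_div_le hη h.1
  have h3 := half_sq_le_tsallisDiv h.1 h'.1 (h.pos hη)
  have h4 := half_sq_le_tsallisDiv h'.1 h.1 (h'.pos hη)
  have h5 : ∑ i, (p i - p' i) ^ 2 / 2 = ∑ i, (p' i - p i) ^ 2 / 2 :=
    Finset.sum_congr rfl fun i _ => by ring
  have h6 : ∑ i, (p' i - p i) ^ 2 = ∑ i, (p' i - p i) ^ 2 / 2 + ∑ i, (p' i - p i) ^ 2 / 2 := by
    rw [← Finset.sum_add_distrib]
    exact Finset.sum_congr rfl fun i _ => by ring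
  have h7 : (∑ i, p' i * C i - ∑ i, p i * C i) + (∑ i, p i * C' i - ∑ i, p' i * C' i)
      ≤ ∑ i, |C' i - C i| := by
    rw [← Finset.sum_sub_distrib, ← Finset.sum_sub_distrib, ← Finset.sum_add_distrib]
    refine Finset.sum_le_sum fun i _ => ?_
    have : |p i - p' i| ≤ 1 := by
      rw [abs_le]
      constructor <;> linarith [h.1.1 i, h'.1.1 i, le_one_of_mem_stdSimplex h.1 i,
        le_one_of_mem_stdSimplex h'.1 i]
    calc _ = (p i - p' i) * (C' i - C i) := by ring
      _ ≤ |(p i - p' i) * (C' i - C i)| := le_abs_self _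
      _ = |p i - p' i| * |C' i - C i| := abs_mul _ _
      _ ≤ 1 * |C' i - C i| := mul_le_mul_of_nonneg_right this (abs_nonneg _)
      _ = _ := one_mul _
  have h8 : tsallisDiv p' p / η + tsallisDiv p p' / η ≤ ∑ i, |C' i - C i| := by linarith
  rw [← add_div, div_le_iff₀ hη] at h8
  linarith

lemma IsTsallisWeights.unique {p' : Fin K → ℝ} (h : IsTsallisWeights η C p)
    (h' : IsTsallisWeights η C p') (hη : 0 < η) : p = p' := by
  have h1 := h.sum_sq_le h' hη
  simp only [sub_self, abs_zero, Finset.sum_const_zero, mul_zero] at h1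
  ext i
  have h2 := (Finset.single_le_sum (f := fun i => (p' i - p i) ^ 2) (fun j _ => sq_nonneg _)
    (Finset.mem_univ i)).trans h1
  have h3 : p' i - p i = 0 := by
    have := le_antisymm h2 (sq_nonneg _)
    simpa using this
  linarith

lemma exists_isTsallisWeights [NeZero K] (η : ℝ) (C : Fin K → ℝ) :
    ∃ p, IsTsallisWeights η C p := by
  have hc : Continuous (tsallisObjective η C) := by
    unfold tsallisObjective
    fun_prop
  obtain ⟨p, hp, h⟩ := (isCompact_stdSimplex ℝ (Fin K)).exists_isMinOn
    ⟨_, single_mem_stdSimplex ℝ (0 : Fin K)⟩ hc.continuousOn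
  exact ⟨p, hp, h⟩

/-- The Tsallis-INF weights as a function of the cumulative loss estimates. -/
noncomputable def tsallisWeights [NeZero K] (η : ℝ) (C : Fin K → ℝ) : Fin K → ℝ :=
  (exists_isTsallisWeights η C).choose

lemma isTsallisWeights_tsallisWeights [NeZero K] (η : ℝ) (C : Fin K → ℝ) :
    IsTsallisWeights η C (tsallisWeights η C) :=
  (exists_isTsallisWeights η C).choose_spec

lemma continuous_tsallisWeights [NeZero K] (hη : 0 < η) :
    Continuous (tsallisWeights η : (Fin K → ℝ) → Fin K → ℝ) := by
  refine continuous_pi fun i => continuous_iff_continuousAt.2 fun C => ?_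
  rw [ContinuousAt, tendsto_iff_norm_sub_tendsto_zero]
  have h1 : Filter.Tendsto (fun C' : Fin K → ℝ => √(η * ∑ i, |C' i - C i|)) (nhds C) (nhds 0) := by
    have : Continuous (fun C' : Fin K → ℝ => √(η * ∑ i, |C' i - C i|)) := by fun_prop
    simpa using this.tendsto C
  refine squeeze_zero (fun _ => norm_nonneg _) (fun C' => ?_) h1
  refine Real.le_sqrt_of_sq_le ?_
  rw [Real.norm_eq_abs, sq_abs]
  exact (Finset.single_le_sum (f := fun i => (tsallisWeights η C' i - tsallisWeights η C i) ^ 2)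
    (fun j _ => sq_nonneg _) (Finset.mem_univ i)).trans
    ((isTsallisWeights_tsallisWeights η C).sum_sq_le (isTsallisWeights_tsallisWeights η C') hη)

lemma IsTsallisWeights.eq_uniform (h : IsTsallisWeights η 0 p) (hη : 0 < η) (i : Fin K) :
    p i = 1 / K := by
  have hK : (0 : ℝ) < K := by
    have := i.pos
    exact_mod_cast this
  have hu : (fun _ => 1 / (K : ℝ)) ∈ stdSimplex ℝ (Fin K) :=
    ⟨fun _ => by positivity, by simp [hK.ne']⟩
  have h1 := h.le hu
  simp only [Pi.zero_apply, mul_zero, Finset.sum_const_zero, zero_sub, neg_le_neg_iff] at h1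
  have h2 : ∑ j : Fin K, √(1 / (K : ℝ)) ≤ ∑ j, √(p j) :=
    le_of_mul_le_mul_left h1 (by positivity)
  set q : ℝ := √(1 / (K : ℝ)) with hq
  have hq0 : 0 < q := by positivity
  have hq2 : q ^ 2 = 1 / K := Real.sq_sqrt (by positivity)
  have h3 : ∑ j, (√(p j) - q) ^ 2 = 2 - 2 * q * ∑ j, √(p j) := by
    have : ∀ j, (√(p j) - q) ^ 2 = p j + q ^ 2 - 2 * q * √(p j) := fun j => by
      rw [sub_sq, Real.sq_sqrt (h.1.1 j)]; ring
    rw [Finset.sum_congr rfl fun j _ => this j, Finset.sum_sub_distrib, Finset.sum_add_distrib,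
      h.1.2, ← Finset.mul_sum, hq2]
    simp [hK.ne']
    norm_num
  have h4 : ∑ j : Fin K, q = K * q := by simp
  have h5 : q * (K * q) = 1 := by
    have : q * (K * q) = K * q ^ 2 := by ring
    rw [this, hq2]; field_simp
  have h6 : ∑ j, (√(p j) - q) ^ 2 ≤ 0 := by
    rw [h3]; nlinarith [mul_le_mul_of_nonneg_left h2 hq0.le]
  have h7 : (√(p i) - q) ^ 2 = 0 := le_antisymm
    ((Finset.single_le_sum (f := fun j => (√(p j) - q) ^ 2) (fun j _ => sq_nonneg _)
      (Finset.mem_univ i)).trans h6) (sq_nonneg _)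
  have h8 : √(p i) = q := by
    have := pow_eq_zero_iff (two_ne_zero) |>.1 h7
    linarith
  rw [← Real.sq_sqrt (h.1.1 i), h8, hq2]

end Deterministic

/-! ### Follow-the-regularised-leader regret along one path -/

section Deterministic

variable {K : ℕ}

lemma ftrl_le {η β s : ℕ → ℝ} {C p l : ℕ → Fin K → ℝ} (hη : ∀ t, 1 ≤ t → 0 < η t)
    (hβ0 : β 0 = 0) (hβ : ∀ t, 1 ≤ t → β t = 4 / η t) (hC1 : C 1 = 0)
    (hC : ∀ t, 1 ≤ t → C (t + 1) = C t + l t)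
    (hp : ∀ t, 1 ≤ t → IsTsallisWeights (η t) (C t) (p t))
    (hs : ∀ t, 1 ≤ t → ∀ w ∈ stdSimplex ℝ (Fin K),
      ∑ i, (p t i - w i) * l t i ≤ tsallisDiv w (p t) / η t + s t) (T : ℕ) :
    ∀ w ∈ stdSimplex ℝ (Fin K),
      ∑ t ∈ Finset.Icc 1 T, ∑ i, p t i * l t i + β T * ∑ i, √(w i)
        ≤ ∑ i, w i * C (T + 1) i
          + ∑ t ∈ Finset.Icc 1 T, (s t + (β t - β (t - 1)) * ∑ i, √(p t i)) := by
  induction T with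
  | zero => intro w _; simp [hβ0, hC1]
  | succ T ih =>
    intro w hw
    have hT : 1 ≤ T + 1 := Nat.le_add_left 1 T
    -- The induction hypothesis is used at the next leader. Passing from this leader to $w$ leaves a
    -- surplus divergence, which pays for the one in `hs`.
    have h1 := ih (p (T + 1)) (hp _ hT).1
    have h2 := (hp _ hT).add_div_le (hη _ hT) hw
    have h3 := hs _ hT w hw
    rw [← hβ _ hT] at h2
    rw [Finset.sum_Icc_succ_top hT, Finset.sum_Icc_succ_top hT, hC _ hT, Nat.add_sub_cancel]
    have h4 : ∑ i, (p (T + 1) i - w i) * l (T + 1) i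
        = ∑ i, p (T + 1) i * l (T + 1) i - ∑ i, w i * l (T + 1) i := by
      rw [← Finset.sum_sub_distrib]
      exact Finset.sum_congr rfl fun i _ => by ring
    have h5 : ∑ i, w i * (C (T + 1) + l (T + 1)) i
        = ∑ i, w i * C (T + 1) i + ∑ i, w i * l (T + 1) i := by
      rw [← Finset.sum_add_distrib]
      exact Finset.sum_congr rfl fun i _ => by rw [Pi.add_apply]; ring
    rw [h5]
    linarith

/-- The regret of Tsallis-INF against a fixed arm is at most the sum of its stability terms `s`
and its penalty terms. -/
lemma ftrl_regret_le {η β s : ℕ → ℝ} {C p l : ℕ → Fin K → ℝ} (hη : ∀ t, 1 ≤ t → 0 < η t)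
    (hβ0 : β 0 = 0) (hβ : ∀ t, 1 ≤ t → β t = 4 / η t) (hC1 : C 1 = 0)
    (hC : ∀ t, 1 ≤ t → C (t + 1) = C t + l t)
    (hp : ∀ t, 1 ≤ t → IsTsallisWeights (η t) (C t) (p t))
    (hs : ∀ t, 1 ≤ t → ∀ w ∈ stdSimplex ℝ (Fin K),
      ∑ i, (p t i - w i) * l t i ≤ tsallisDiv w (p t) / η t + s t) (T : ℕ) (u : Fin K) :
    ∑ t ∈ Finset.Icc 1 T, (∑ i, p t i * l t i - l t u)
      ≤ ∑ t ∈ Finset.Icc 1 T, (s t + (β t - β (t - 1)) * (∑ i, √(p t i) - 1)) := by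
  have h1 := ftrl_le hη hβ0 hβ hC1 hC hp hs T _ (single_mem_stdSimplex ℝ u)
  have h2 : ∑ i, √((Pi.single u 1 : Fin K → ℝ) i) = 1 := by
    rw [Finset.sum_eq_single u] <;> simp +contextual
  have h3 : ∑ i, (Pi.single u 1 : Fin K → ℝ) i * C (T + 1) i = C (T + 1) u := by
    simp [Pi.single_apply]
  have h4 : ∀ T, C (T + 1) u = ∑ t ∈ Finset.Icc 1 T, l t u := by
    intro T
    induction T with
    | zero => simp [hC1]
    | succ T ih =>
      rw [Finset.sum_Icc_succ_top (Nat.le_add_left 1 T), hC _ (Nat.le_add_left 1 T),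
        Pi.add_apply, ih]
  have h5 : β T = ∑ t ∈ Finset.Icc 1 T, (β t - β (t - 1)) := by
    clear h1 h3
    induction T with
    | zero => simp [hβ0]
    | succ T ih =>
      rw [Finset.sum_Icc_succ_top (Nat.le_add_left 1 T), ← ih, Nat.add_sub_cancel]
      ring
  rw [h2, h3, h4, h5] at h1
  simp only [mul_sub, mul_one, Finset.sum_sub_distrib, Finset.sum_add_distrib] at h1 ⊢
  linarith

/-! ### Stability terms and elementary sums -/

lemma sum_filter_ne (f : Fin K → ℝ) (a : Fin K) :
    ∑ i ∈ Finset.univ.filter (fun i => i ≠ a), f i = ∑ i, f i - f a := by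
  rw [Finset.filter_ne', eq_sub_iff_add_eq, Finset.sum_erase_add _ _ (Finset.mem_univ a)]

/-- For a nonnegative loss no bound on the step size is needed: in square-root variables the slack
is a square plus $(a-b)^2r$. -/
lemma stability_coord_lower {η x y r : ℝ} (hη : 0 < η) (hx : 0 < x) (hy : 0 ≤ y) (hr : 0 ≤ r) :
    (x - y) * r ≤ 2 * (√y - √x) ^ 2 / √x / η + η / 2 * r ^ 2 * (x * √x) := by
  obtain ⟨a, ha, rfl⟩ : ∃ a, 0 < a ∧ x = a ^ 2 := ⟨√x, Real.sqrt_pos.2 hx, (Real.sq_sqrt hx.le).symm⟩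
  obtain ⟨b, hb, rfl⟩ : ∃ b, 0 ≤ b ∧ y = b ^ 2 := ⟨√y, Real.sqrt_nonneg y, (Real.sq_sqrt hy).symm⟩
  rw [Real.sqrt_sq ha.le, Real.sqrt_sq hb]
  have e : 2 * (b - a) ^ 2 / a / η + η / 2 * r ^ 2 * (a ^ 2 * a) - (a ^ 2 - b ^ 2) * r
      = (2 * (a - b) - η * r * a ^ 2) ^ 2 / (2 * η * a) + (a - b) ^ 2 * r := by
    field_simp
    ring
  have : 0 ≤ (2 * (a - b) - η * r * a ^ 2) ^ 2 / (2 * η * a) + (a - b) ^ 2 * r := by positivity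
  linarith

/-- The same for a gain $r$, where $(b-a)^2r$ has the wrong sign. Two thirds of the divergence
absorb it, whence the threshold $4/3$; the remaining third completes the square, whence the larger
factor $3/2$. -/
lemma stability_coord_upper {η x y r : ℝ} (hη : 0 < η) (hx : 0 < x) (hy : 0 ≤ y)
    (h : η * √x * r ≤ 4 / 3) :
    (y - x) * r ≤ 2 * (√y - √x) ^ 2 / √x / η + 3 / 2 * η * r ^ 2 * (x * √x) := by
  obtain ⟨a, ha, rfl⟩ : ∃ a, 0 < a ∧ x = a ^ 2 := ⟨√x, Real.sqrt_pos.2 hx, (Real.sq_sqrt hx.le).symm⟩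
  obtain ⟨b, hb, rfl⟩ : ∃ b, 0 ≤ b ∧ y = b ^ 2 := ⟨√y, Real.sqrt_nonneg y, (Real.sq_sqrt hy).symm⟩
  rw [Real.sqrt_sq ha.le] at h
  rw [Real.sqrt_sq ha.le, Real.sqrt_sq hb]
  have e : 2 * (b - a) ^ 2 / a / η + 3 / 2 * η * r ^ 2 * (a ^ 2 * a) - (b ^ 2 - a ^ 2) * r
      = (4 / 3 - η * a * r) * (b - a) ^ 2 / (η * a)
        + (2 * (b - a) - 3 * η * r * a ^ 2) ^ 2 / (6 * η * a) := by
    field_simp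
    ring
  have : 0 ≤ (4 / 3 - η * a * r) * (b - a) ^ 2 / (η * a)
        + (2 * (b - a) - 3 * η * r * a ^ 2) ^ 2 / (6 * η * a) := by
    have := sub_nonneg.2 h
    positivity
  linarith

variable {η r : ℝ} {p w : Fin K → ℝ}

lemma stability_le (hη : 0 < η) (hpos : ∀ i, 0 < p i) (hw : w ∈ stdSimplex ℝ (Fin K))
    (hr : 0 ≤ r) (j : Fin K) :
    (p j - w j) * r ≤ tsallisDiv w p / η + η / 2 * r ^ 2 * (p j * √(p j)) := by
  refine (stability_coord_lower hη (hpos j) (hw.1 j) hr).trans ?_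
  gcongr
  exact Finset.single_le_sum (f := fun i => 2 * (√(w i) - √(p i)) ^ 2 / √(p i))
    (fun i _ => by positivity) (Finset.mem_univ j)

lemma stability_le_sum_ne (hη : 0 < η) (hp : p ∈ stdSimplex ℝ (Fin K)) (hpos : ∀ i, 0 < p i)
    (hw : w ∈ stdSimplex ℝ (Fin K)) (a : Fin K) (h : ∀ i, i ≠ a → η * √(p i) * r ≤ 4 / 3) :
    (p a - w a) * r ≤ tsallisDiv w p / η
      + ∑ i ∈ Finset.univ.filter (fun i => i ≠ a), 3 / 2 * η * r ^ 2 * (p i * √(p i)) := by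
  -- Both vectors sum to one, so shifting all losses by a constant is free and the loss of $a$
  -- becomes a gain of the others.
  have e : p a - w a = ∑ i ∈ Finset.univ.filter (fun i => i ≠ a), (w i - p i) := by
    rw [sum_filter_ne, Finset.sum_sub_distrib, hw.2, hp.2]
    ring
  have h1 : ∑ i ∈ Finset.univ.filter (fun i => i ≠ a), 2 * (√(w i) - √(p i)) ^ 2 / √(p i) / η
      ≤ tsallisDiv w p / η := by
    rw [← Finset.sum_div, tsallisDiv]
    gcongr
    exact Finset.filter_subset _ _
  rw [e, Finset.sum_mul]
  refine le_trans (Finset.sum_le_sum fun i hi => stability_coord_upper hη (hpos i) (hw.1 i)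
    (h i (Finset.mem_filter.1 hi).2)) ?_
  rw [Finset.sum_add_distrib]
  linarith

variable {B x : ℝ} {t : ℕ}

lemma tsallis_stability_le (hB : 0 < B) (ht : 1 ≤ t) (hpos : ∀ i, 0 < p i)
    (hw : w ∈ stdSimplex ℝ (Fin K)) (hx : x ∈ Set.Icc 0 B) (j : Fin K) :
    (p j - w j) * (x / p j) ≤ tsallisDiv w p / (2 / (B * √(t : ℝ)))
      + B / √(t : ℝ) * (√(p j) / p j) := by
  have ht : (0 : ℝ) < √(t : ℝ) := Real.sqrt_pos.2 (by exact_mod_cast ht)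
  refine (stability_le (by positivity) hpos hw (div_nonneg hx.1 (hpos j).le) j).trans
    (add_le_add le_rfl ?_)
  have hx2 : x ^ 2 ≤ B ^ 2 := pow_le_pow_left₀ hx.1 hx.2 2
  have := hpos j
  calc _ = x ^ 2 * (1 / (B * √(t : ℝ)) * (√(p j) / p j)) := by field_simp
    _ ≤ B ^ 2 * (1 / (B * √(t : ℝ)) * (√(p j) / p j)) := by gcongr
    _ = _ := by field_simp

lemma sum_le_sq_sum_sqrt {s : Finset (Fin K)} (hp : ∀ i, 0 ≤ p i) :
    ∑ i ∈ s, p i ≤ (∑ i ∈ s, √(p i)) ^ 2 := by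
  rw [sq, Finset.sum_mul]
  refine Finset.sum_le_sum fun i hi => ?_
  calc p i = √(p i) * √(p i) := (Real.mul_self_sqrt (hp i)).symm
    _ ≤ _ := mul_le_mul_of_nonneg_left
      (Finset.single_le_sum (f := fun i => √(p i)) (fun j _ => Real.sqrt_nonneg _) hi)
      (Real.sqrt_nonneg _)

lemma tsallis_stability_le_sum_ne (hB : 0 < B) (ht : 1 ≤ t) (hp : p ∈ stdSimplex ℝ (Fin K))
    (hpos : ∀ i, 0 < p i) (hu : t = 1 → ∀ i j, p i = p j)
    (hw : w ∈ stdSimplex ℝ (Fin K)) (hx : x ∈ Set.Icc 0 B) (a : Fin K) :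
    (p a - w a) * (x / p a) ≤ tsallisDiv w p / (2 / (B * √(t : ℝ)))
      + 3 / 2 * (B / √(t : ℝ)) * ((∑ i ∈ Finset.univ.filter (fun i => i ≠ a), √(p i)) / p a) := by
  have ht' : (0 : ℝ) < √(t : ℝ) := Real.sqrt_pos.2 (by exact_mod_cast ht)
  have ha := hpos a
  have hsum := sum_filter_ne p a
  rw [hp.2] at hsum
  set S := ∑ i ∈ Finset.univ.filter (fun i => i ≠ a), √(p i) with hS
  have hS0 : 0 ≤ S := Finset.sum_nonneg fun i _ => Real.sqrt_nonneg _
  -- If $p_a\le2/3$, the other arms have mass at least $1/3$, so $\sqrt{p_a}\le\frac32S$ and the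
  -- plain stability bound suffices. Otherwise the other weights are at most $1/3$, small enough for
  -- the gain bound.
  rcases le_or_gt (p a) (2 / 3) with hle | hgt
  · refine (tsallis_stability_le hB ht hpos hw hx a).trans ?_
    have h1 : ∑ i ∈ Finset.univ.filter (fun i => i ≠ a), p i ≤ S ^ 2 := sum_le_sq_sum_sqrt hp.1
    have h2 : √(p a) ≤ 3 / 2 * S := by
      apply Real.sqrt_le_iff.2 ⟨by positivity, ?_⟩
      nlinarith
    have h3 : B / √(t : ℝ) * (√(p a) / p a) ≤ B / √(t : ℝ) * (3 / 2 * S / p a) := by gcongr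
    have e : B / √(t : ℝ) * (3 / 2 * S / p a) = 3 / 2 * (B / √(t : ℝ)) * (S / p a) := by ring
    linarith
  · have hr : x / p a ≤ B / p a := by have := hx.2; gcongr
    have hr0 : 0 ≤ x / p a := div_nonneg hx.1 ha.le
    have hi : ∀ i, i ≠ a → p i ≤ 1 / 3 := by
      intro i hi
      have := Finset.single_le_sum (s := Finset.univ.filter (fun i => i ≠ a)) (f := p)
        (fun j _ => hp.1 j) (Finset.mem_filter.2 ⟨Finset.mem_univ i, hi⟩)
      linarith
    have hstep : ∀ i, i ≠ a → 2 / (B * √(t : ℝ)) * √(p i) * (x / p a) ≤ 4 / 3 := by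
      intro i hia
      have hpi := hi i hia
      -- The first learning rate is too large for the estimate below, but uniform weights exclude
      -- this case in round 1.
      have ht2 : 2 ≤ t := by
        rcases Nat.lt_or_ge 1 t with h | h
        · exact h
        · have := hu (le_antisymm h ht) i a
          linarith
      have h1 : 2 / (B * √(t : ℝ)) * √(p i) * (x / p a)
          ≤ 2 / (B * √(t : ℝ)) * √(p i) * (B / p a) := by gcongr
      refine h1.trans ?_
      have e : 2 / (B * √(t : ℝ)) * √(p i) * (B / p a) = 2 * √(p i) / (√(t : ℝ) * p a) := by
        field_simp
      rw [e, div_le_iff₀ (by positivity)]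
      have h2 : 2 * √(p i) ≤ 8 / 9 * √(t : ℝ) := by
        rw [← Real.sqrt_sq (by norm_num : (0 : ℝ) ≤ 2), ← Real.sqrt_mul (by norm_num),
          ← Real.sqrt_sq (by norm_num : (0 : ℝ) ≤ 8 / 9), ← Real.sqrt_mul (by norm_num)]
        apply Real.sqrt_le_sqrt
        have : (2 : ℝ) ≤ t := by exact_mod_cast ht2
        nlinarith
      nlinarith
    refine (stability_le_sum_ne (by positivity) hp hpos hw a hstep).trans ?_
    gcongr
    rw [hS, Finset.sum_div, Finset.mul_sum]
    refine Finset.sum_le_sum fun i hia => ?_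
    have hpi := hi i (Finset.mem_filter.1 hia).2
    have h1 : (x / p a) ^ 2 ≤ (B / p a) ^ 2 := pow_le_pow_left₀ hr0 hr 2
    have := hpos i
    calc _ ≤ 3 / 2 * (2 / (B * √(t : ℝ))) * (B / p a) ^ 2 * (p i * √(p i)) := by gcongr
      _ = 3 / 2 * (B / √(t : ℝ)) * (√(p i) / p a) * (2 * p i / p a) := by field_simp
      _ ≤ 3 / 2 * (B / √(t : ℝ)) * (√(p i) / p a) * 1 := by
        gcongr
        rw [div_le_one ha]
        linarith
      _ = _ := mul_one _

lemma sqrt_sub_sqrt_pred_le (ht : 1 ≤ t) :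
    √(t : ℝ) - √((t - 1 : ℕ) : ℝ) ≤ 1 / √(t : ℝ) := by
  have ht' : (0 : ℝ) < √(t : ℝ) := Real.sqrt_pos.2 (by exact_mod_cast ht)
  rw [le_div_iff₀ ht', sub_mul, Real.mul_self_sqrt (Nat.cast_nonneg t)]
  have h1 : ((t - 1 : ℕ) : ℝ) = t - 1 := by push_cast [ht]; ring
  have h2 : √((t - 1 : ℕ) : ℝ) ≤ √(t : ℝ) := Real.sqrt_le_sqrt (by rw [h1]; linarith)
  have h3 := Real.mul_self_sqrt (Nat.cast_nonneg (α := ℝ) (t - 1))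
  nlinarith [Real.sqrt_nonneg ((t - 1 : ℕ) : ℝ)]

lemma sum_inv_sqrt_le (T : ℕ) : ∑ t ∈ Finset.Icc 1 T, 1 / √(t : ℝ) ≤ 2 * √(T : ℝ) := by
  induction T with
  | zero => simp
  | succ T ih =>
    rw [Finset.sum_Icc_succ_top (Nat.le_add_left 1 T)]
    have h0 : (0 : ℝ) < √((T + 1 : ℕ) : ℝ) := Real.sqrt_pos.2 (by positivity)
    have h1 := Real.sq_sqrt (Nat.cast_nonneg (α := ℝ) (T + 1))
    have h2 := Real.sq_sqrt (Nat.cast_nonneg (α := ℝ) T)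
    have h3 : 1 / √((T + 1 : ℕ) : ℝ) ≤ 2 * √((T + 1 : ℕ) : ℝ) - 2 * √(T : ℝ) := by
      rw [div_le_iff₀ h0]
      push_cast at h1 ⊢
      nlinarith [sq_nonneg (√((T : ℝ) + 1) - √(T : ℝ))]
    linarith

lemma sum_inv_le_log (T : ℕ) : ∑ t ∈ Finset.Icc 1 T, 1 / (t : ℝ) ≤ Real.log T + 1 := by
  have h := harmonic_le_one_add_log T
  rw [harmonic_eq_sum_Icc] at h
  push_cast at h
  simp only [one_div]
  linarith

end Deterministic

/-! ### Measurability and boundedness of the sampling weights -/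

section Measurability

variable {Ω : Type*} {K : ℕ} {B : ℝ} {η : ℕ → ℝ} {ℓ : ℕ → Ω → Fin K → ℝ} {J : ℕ → Ω → Fin K}
  {p : ℕ → Ω → Fin K → ℝ} {D : Fin K → Fin K → ℝ}

lemma cumLossEstimate_one (ω : Ω) : cumLossEstimate ℓ J p 1 ω = 0 := by
  ext i
  simp [cumLossEstimate]

lemma cumLossEstimate_succ {t : ℕ} (ht : 1 ≤ t) (ω : Ω) :
    cumLossEstimate ℓ J p (t + 1) ω = cumLossEstimate ℓ J p t ω + lossEstimate ℓ J p t ω := by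
  ext i
  simp [cumLossEstimate, Finset.sum_Ico_succ_top ht]

/-- By uniqueness the weights are a continuous function of the cumulative estimates, which involve
only earlier weights; hence strong induction. -/
lemma measurable_weights [MeasurableSpace Ω] [NeZero K] (hη : ∀ t, 1 ≤ t → 0 < η t)
    (hw : ∀ t, 1 ≤ t → ∀ ω, IsTsallisWeights (η t) (cumLossEstimate ℓ J p t ω) (p t ω))
    (t : ℕ) (ht : 1 ≤ t) (hℓ : ∀ s ∈ Finset.Ico 1 t, Measurable (ℓ s))
    (hJ : ∀ s ∈ Finset.Ico 1 t, Measurable (J s)) : Measurable (p t) := by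
  induction t using Nat.strong_induction_on with
  | _ t ih =>
    have h1 : p t = fun ω => tsallisWeights (η t) (cumLossEstimate ℓ J p t ω) := by
      ext1 ω
      exact (hw t ht ω).unique (isTsallisWeights_tsallisWeights _ _) (hη t ht)
    rw [h1]
    refine (continuous_tsallisWeights (hη t ht)).measurable.comp ?_
    refine measurable_pi_lambda _ fun i => Finset.measurable_sum _ fun s hs => ?_
    have hs' := Finset.mem_Ico.1 hs
    have hp : Measurable (p s) := ih s hs'.2 hs'.1
      (fun r hr => hℓ r (Finset.Ico_subset_Ico_right hs'.2.le hr))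
      (fun r hr => hJ r (Finset.Ico_subset_Ico_right hs'.2.le hr))
    refine Measurable.ite (hJ s hs (measurableSet_singleton i)) ?_ measurable_const
    exact ((measurable_pi_apply i).comp (hℓ s hs)).div ((measurable_pi_apply i).comp hp)

lemma measurable_weights_past [NeZero K] (hη : ∀ t, 1 ≤ t → 0 < η t)
    (hw : ∀ t, 1 ≤ t → ∀ ω, IsTsallisWeights (η t) (cumLossEstimate ℓ J p t ω) (p t ω))
    {t s : ℕ} (hs : 1 ≤ s) (hst : s ≤ t) (i : Fin K) :
    Measurable[pastLosses ℓ t ⊔ pastArms J s] (fun ω => p s ω i) := by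
  let m := pastLosses ℓ t ⊔ pastArms J s
  have h : Measurable[m] (p s) := by
    -- The history σ-algebra takes the place of the ambient one, so measurability becomes
    -- adaptedness.
    refine @measurable_weights _ _ _ _ _ _ m _ hη hw s hs (fun r hr => ?_) (fun r hr => ?_)
    · have hr' : r ∈ Finset.Ico 1 t := Finset.Ico_subset_Ico_right hst hr
      exact measurable_iff_comap_le.2 ((le_iSup₂_of_le
        (f := fun r (_ : r ∈ Finset.Ico 1 t) => MeasurableSpace.comap (ℓ r) inferInstance)
        r hr' le_rfl).trans le_sup_left)
    · exact measurable_iff_comap_le.2 ((le_iSup₂_of_le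
        (f := fun r (_ : r ∈ Finset.Ico 1 s) => MeasurableSpace.comap (J r) inferInstance)
        r hr le_rfl).trans le_sup_right)
  exact (measurable_pi_apply i).comp h

lemma pastLosses_le_allLosses (t : ℕ) : pastLosses ℓ t ≤ allLosses ℓ :=
  iSup₂_le fun s hs => le_iSup₂_of_le s (Finset.mem_Ico.1 hs).1 le_rfl

lemma measurable_allLosses {s t : ℕ} (hs : 1 ≤ s) (i : Fin K) :
    Measurable[allLosses ℓ ⊔ pastArms J t] (fun ω => ℓ s ω i) := by
  have h : Measurable[allLosses ℓ ⊔ pastArms J t] (ℓ s) :=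
    measurable_iff_comap_le.2 ((le_iSup₂_of_le (f := fun (s : ℕ) (_ : 1 ≤ s) =>
      MeasurableSpace.comap (ℓ s) inferInstance) s hs le_rfl).trans le_sup_left)
  exact (measurable_pi_apply i).comp h

lemma pastArms_succ {t : ℕ} (ht : 1 ≤ t) :
    pastArms J (t + 1) = pastArms J t ⊔ MeasurableSpace.comap (J t) inferInstance := by
  unfold pastArms
  rw [← Finset.insert_Ico_right_eq_Ico_add_one ht, Finset.iSup_insert, sup_comm]

/-- On $\{X=j\}$ the variable $X$ is constant, so adjoining it adds nothing to the trace of `m`. -/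
lemma exists_measurableSet_inter_eq {m : MeasurableSpace Ω} {X : Ω → Fin K} {S : Set Ω}
    (hS : MeasurableSet[m ⊔ MeasurableSpace.comap X inferInstance] S) (j : Fin K) :
    ∃ A, MeasurableSet[m] A ∧ ∀ ω, X ω = j → (ω ∈ S ↔ ω ∈ A) := by
  let v : {ω // X ω = j} → Ω := Subtype.val
  have h1 : MeasurableSet[(m ⊔ MeasurableSpace.comap X inferInstance).comap v] (v ⁻¹' S) :=
    ⟨S, hS, rfl⟩
  have h2 : X ∘ v = fun _ => j := funext fun ω => ω.2
  rw [MeasurableSpace.comap_sup, MeasurableSpace.comap_comp, h2, MeasurableSpace.comap_const,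
    sup_bot_eq] at h1
  obtain ⟨A, hA, hAS⟩ := h1
  refine ⟨A, hA, fun ω hω => ?_⟩
  exact (Set.ext_iff.1 hAS ⟨ω, hω⟩).symm

lemma weights_le_one (hw : ∀ t, 1 ≤ t → ∀ ω, IsTsallisWeights (η t) (cumLossEstimate ℓ J p t ω) (p t ω))
    {t : ℕ} (ht : 1 ≤ t) (ω : Ω) (i : Fin K) : |p t ω i| ≤ 1 := by
  rw [abs_of_nonneg ((hw t ht ω).1.1 i)]
  exact le_one_of_mem_stdSimplex (hw t ht ω).1 i

/-- Bounds uniform in $\omega$, for integrability only: bounded cumulative estimates bound the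
inverse weights, which in turn bound the next estimates. -/
lemma exists_inv_weights_le (hη : ∀ t, 1 ≤ t → 0 < η t)
    (hℓ : ∀ t, 1 ≤ t → ∀ ω i, ℓ t ω i ∈ Set.Icc 0 B)
    (hw : ∀ t, 1 ≤ t → ∀ ω, IsTsallisWeights (η t) (cumLossEstimate ℓ J p t ω) (p t ω))
    {t : ℕ} (ht : 1 ≤ t) : ∃ M : ℝ, ∀ ω i, 1 / p t ω i ≤ M := by
  have h : ∃ M, ∀ ω i, cumLossEstimate ℓ J p t ω i ∈ Set.Icc 0 M := by
    induction t, ht using Nat.le_induction with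
    | base => exact ⟨0, fun ω i => by simp [cumLossEstimate_one]⟩
    | succ t ht ih =>
      obtain ⟨M, hM⟩ := ih
      refine ⟨M + |B| * (√(K : ℝ) + η t / 2 * M) ^ 2, fun ω i => ?_⟩
      have hp := (hw t ht ω).pos (hη t ht) i
      have hl := hℓ t ht ω i
      have h0 := hη t ht
      have h1 : 1 / √(p t ω i) ≤ √(K : ℝ) + η t / 2 * M :=
        ((hw t ht ω).inv_sqrt_le h0 (fun i => (hM ω i).1) i).trans (by
          have := (hM ω i).2
          gcongr)
      have h2 : 1 / p t ω i ≤ (√(K : ℝ) + η t / 2 * M) ^ 2 := by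
        have := pow_le_pow_left₀ (by positivity) h1 2
        rwa [div_pow, one_pow, Real.sq_sqrt hp.le] at this
      have h3 : lossEstimate ℓ J p t ω i ∈ Set.Icc 0 (|B| * (√(K : ℝ) + η t / 2 * M) ^ 2) := by
        rw [lossEstimate]
        split_ifs
        · refine ⟨div_nonneg hl.1 hp.le, ?_⟩
          calc _ = ℓ t ω i * (1 / p t ω i) := by ring
            _ ≤ |B| * (√(K : ℝ) + η t / 2 * M) ^ 2 :=
              mul_le_mul (hl.2.trans (le_abs_self B)) h2 (by positivity) (abs_nonneg B)
        · exact ⟨le_rfl, by positivity⟩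
      rw [cumLossEstimate_succ ht, Pi.add_apply]
      exact ⟨add_nonneg (hM ω i).1 h3.1, add_le_add (hM ω i).2 h3.2⟩
  obtain ⟨M, hM⟩ := h
  refine ⟨(√(K : ℝ) + η t / 2 * M) ^ 2, fun ω i => ?_⟩
  have hp := (hw t ht ω).pos (hη t ht) i
  have h0 := hη t ht
  have h1 : 1 / √(p t ω i) ≤ √(K : ℝ) + η t / 2 * M :=
    ((hw t ht ω).inv_sqrt_le h0 (fun i => (hM ω i).1) i).trans (by
      have := (hM ω i).2
      gcongr)
  have := pow_le_pow_left₀ (by positivity) h1 2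
  rwa [div_pow, one_pow, Real.sq_sqrt hp.le] at this

end Measurability

/-! ### Integrating out the sampled arm; obliviousness -/

section Sampling

variable {Ω : Type*} [m0 : MeasurableSpace Ω] {μ : Measure Ω} {K : ℕ}
  {B : ℝ} {η : ℕ → ℝ} {ℓ : ℕ → Ω → Fin K → ℝ} {J : ℕ → Ω → Fin K}
  {p : ℕ → Ω → Fin K → ℝ} {D : Fin K → Fin K → ℝ}

lemma IsLossSequence.allLosses_le (hℓ : IsLossSequence B ℓ) : allLosses ℓ ≤ m0 :=
  iSup₂_le fun s hs => (hℓ.measurable s hs).comap_le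

lemma IsTsallisINF.pastArms_le (hJ : IsTsallisINF μ η ℓ J p) (t : ℕ) : pastArms J t ≤ m0 :=
  iSup₂_le fun s hs => (hJ.measurable s (Finset.mem_Ico.1 hs).1).comap_le

lemma IsTsallisINF.measurable_weights [NeZero K] (hη : ∀ t, 1 ≤ t → 0 < η t)
    (hℓ : IsLossSequence B ℓ) (hJ : IsTsallisINF μ η ℓ J p) {t : ℕ} (ht : 1 ≤ t) (i : Fin K) :
    Measurable (fun ω => p t ω i) :=
  (measurable_weights_past hη hJ.weights ht le_rfl i).mono
    (sup_le ((pastLosses_le_allLosses t).trans hℓ.allLosses_le) (hJ.pastArms_le t)) le_rfl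

lemma IsTsallisINF.measurable_sqrt_div_weights [NeZero K] (hη : ∀ t, 1 ≤ t → 0 < η t)
    (hJ : IsTsallisINF μ η ℓ J p) {t : ℕ} (ht : 1 ≤ t) (i j : Fin K) :
    Measurable[allLosses ℓ ⊔ pastArms J t] (fun ω => √(p t ω i) / p t ω j) := by
  have h : ∀ i, Measurable[allLosses ℓ ⊔ pastArms J t] (fun ω => p t ω i) := fun i =>
    (measurable_weights_past hη hJ.weights ht le_rfl i).mono
      (sup_le_sup_right (pastLosses_le_allLosses t) _) le_rfl
  exact (h i).sqrt.div (h j)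

lemma IsTsallisINF.exists_sqrt_div_weights_le (hη : ∀ t, 1 ≤ t → 0 < η t)
    (hℓ : IsLossSequence B ℓ) (hJ : IsTsallisINF μ η ℓ J p) {t : ℕ} (ht : 1 ≤ t) :
    ∃ M, ∀ ω i j, |√(p t ω i) / p t ω j| ≤ M := by
  obtain ⟨M, hM⟩ := exists_inv_weights_le hη hℓ.mem_Icc hJ.weights ht
  refine ⟨M, fun ω i j => ?_⟩
  have hj := (hJ.weights t ht ω).pos (hη t ht) j
  rw [abs_of_nonneg (by positivity)]
  refine le_trans ?_ (hM ω j)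
  gcongr
  exact Real.sqrt_le_one.2 (le_one_of_mem_stdSimplex (hJ.weights t ht ω).1 i)

variable [IsProbabilityMeasure μ]

lemma integrable_of_abs_le {f : Ω → ℝ} (hf : Measurable f) {M : ℝ} (h : ∀ ω, |f ω| ≤ M) :
    Integrable f μ :=
  Integrable.of_bound hf.aestronglyMeasurable M (Filter.Eventually.of_forall h)

lemma IsTsallisINF.integral_ite (hℓ : IsLossSequence B ℓ) (hJ : IsTsallisINF μ η ℓ J p) {t : ℕ}
    (ht : 1 ≤ t) (i : Fin K) {g : Ω → ℝ} (hg : Measurable[allLosses ℓ ⊔ pastArms J t] g) {M : ℝ}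
    (hM : ∀ ω, |g ω| ≤ M) :
    ∫ ω, (if J t ω = i then g ω else 0) ∂μ = ∫ ω, p t ω i * g ω ∂μ := by
  have hle : allLosses ℓ ⊔ pastArms J t ≤ m0 := sup_le hℓ.allLosses_le (hJ.pastArms_le t)
  have hset : MeasurableSet {ω | J t ω = i} := hJ.measurable t ht (measurableSet_singleton i)
  set I : Ω → ℝ := Set.indicator {ω | J t ω = i} (fun _ => (1 : ℝ)) with hI
  have hIm : Measurable I := measurable_const.indicator hset
  have hIb : ∀ ω, |I ω| ≤ 1 := fun ω => by
    rw [hI, Set.indicator_apply]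
    split_ifs <;> simp
  have hIi : Integrable I μ := integrable_of_abs_le hIm hIb
  have hgI : Integrable (g * I) μ := by
    refine integrable_of_abs_le ((hg.mono hle le_rfl).mul hIm) (M := M) fun ω => ?_
    rw [Pi.mul_apply, abs_mul]
    calc _ ≤ |g ω| * 1 := mul_le_mul_of_nonneg_left (hIb ω) (abs_nonneg _)
      _ ≤ M := by rw [mul_one]; exact hM ω
  have h1 : ∫ ω, (if J t ω = i then g ω else 0) ∂μ = ∫ ω, (g * I) ω ∂μ := by
    refine integral_congr_ae (Filter.Eventually.of_forall fun ω => ?_)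
    simp [hI, Set.indicator_apply]
  rw [h1, ← integral_condExp hle]
  refine integral_congr_ae ?_
  filter_upwards [condExp_mul_of_stronglyMeasurable_left hg.stronglyMeasurable hgI hIi,
    hJ.sampling t ht i] with ω hω1 hω2
  rw [hω1, Pi.mul_apply, hω2, mul_comm]

lemma IsTsallisINF.integrable_arm (hℓ : IsLossSequence B ℓ) (hJ : IsTsallisINF μ η ℓ J p) {t : ℕ}
    (ht : 1 ≤ t) {f : Ω → Fin K → ℝ}
    (hf : ∀ i, Measurable[allLosses ℓ ⊔ pastArms J t] (fun ω => f ω i)) {M : ℝ}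
    (hM : ∀ ω i, |f ω i| ≤ M) : Integrable (fun ω => f ω (J t ω)) μ := by
  have hle : allLosses ℓ ⊔ pastArms J t ≤ m0 := sup_le hℓ.allLosses_le (hJ.pastArms_le t)
  refine integrable_of_abs_le (M := M) ?_ fun ω => hM ω _
  have h : (fun ω => f ω (J t ω)) = fun ω => ∑ i, if J t ω = i then f ω i else 0 := by
    ext ω; simp
  rw [h]
  exact Finset.measurable_sum _ fun i _ =>
    Measurable.ite (hJ.measurable t ht (measurableSet_singleton i)) ((hf i).mono hle le_rfl)
      measurable_const

/-- The arm of round `t` is drawn from `p t`. -/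
lemma IsTsallisINF.integral_arm [NeZero K] (hη : ∀ t, 1 ≤ t → 0 < η t)
    (hℓ : IsLossSequence B ℓ) (hJ : IsTsallisINF μ η ℓ J p) {t : ℕ}
    (ht : 1 ≤ t) {f : Ω → Fin K → ℝ}
    (hf : ∀ i, Measurable[allLosses ℓ ⊔ pastArms J t] (fun ω => f ω i)) {M : ℝ}
    (hM : ∀ ω i, |f ω i| ≤ M) :
    ∫ ω, f ω (J t ω) ∂μ = ∫ ω, ∑ i, p t ω i * f ω i ∂μ := by
  have hle : allLosses ℓ ⊔ pastArms J t ≤ m0 := sup_le hℓ.allLosses_le (hJ.pastArms_le t)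
  have h : (fun ω => f ω (J t ω)) = fun ω => ∑ i, if J t ω = i then f ω i else 0 := by
    ext ω; simp
  rw [h, integral_finsetSum, integral_finsetSum]
  · exact Finset.sum_congr rfl fun i _ => hJ.integral_ite hℓ ht i (hf i) fun ω => hM ω i
  · intro i _
    refine integrable_of_abs_le (M := M) ((hJ.measurable_weights hη hℓ ht i).mul
      ((hf i).mono hle le_rfl)) fun ω => ?_
    rw [abs_mul]
    calc _ ≤ 1 * |f ω i| :=
          mul_le_mul_of_nonneg_right (weights_le_one hJ.weights ht ω i) (abs_nonneg _)
      _ ≤ M := by rw [one_mul]; exact hM ω i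
  · intro i _
    refine integrable_of_abs_le (M := M) (Measurable.ite
      (hJ.measurable t ht (measurableSet_singleton i)) ((hf i).mono hle le_rfl)
      measurable_const) fun ω => ?_
    split_ifs
    · exact hM ω i
    · rw [abs_zero]; exact (abs_nonneg _).trans (hM ω i)

lemma integral_mul_eq_zero_of_condExp {m : MeasurableSpace Ω} (hm : m ≤ m0) {Y g : Ω → ℝ}
    (hY : Integrable Y μ) (hc : μ[Y | m] =ᵐ[μ] 0) (hg : Measurable[m] g) {M : ℝ}
    (hM : ∀ ω, |g ω| ≤ M) : ∫ ω, g ω * Y ω ∂μ = 0 := by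
  have hi : Integrable (g * Y) μ :=
    hY.bdd_mul (hg.mono hm le_rfl).aestronglyMeasurable (Filter.Eventually.of_forall hM)
  calc ∫ ω, g ω * Y ω ∂μ = ∫ ω, (g * Y) ω ∂μ := rfl
    _ = ∫ ω, (μ[g * Y | m]) ω ∂μ := (integral_condExp hm).symm
    _ = ∫ _, (0 : ℝ) ∂μ := by
      refine integral_congr_ae ?_
      filter_upwards [condExp_mul_of_stronglyMeasurable_left hg.stronglyMeasurable hi hY, hc]
        with ω h1 h2
      rw [h1, Pi.mul_apply, h2, Pi.zero_apply, mul_zero]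
    _ = 0 := integral_zero _ _

/-- Conditioning on the arms played so far, in addition to the past losses, does not change the
conditional expectation of the losses. -/
lemma IsTsallisINF.condExp_pastArms [NeZero K] (hη : ∀ t, 1 ≤ t → 0 < η t)
    (hℓ : IsLossSequence B ℓ) (hJ : IsTsallisINF μ η ℓ J p) {t : ℕ} {Y : Ω → ℝ}
    (hYm : Measurable[allLosses ℓ] Y) {M : ℝ} (hM : ∀ ω, |Y ω| ≤ M)
    (hY : μ[Y | pastLosses ℓ t] =ᵐ[μ] 0) {s : ℕ} (hs : 1 ≤ s) (hst : s ≤ t) :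
    μ[Y | pastLosses ℓ t ⊔ pastArms J s] =ᵐ[μ] 0 := by
  classical
  have hYi : Integrable Y μ := integrable_of_abs_le (hYm.mono hℓ.allLosses_le le_rfl) hM
  have hle : ∀ s, pastLosses ℓ t ⊔ pastArms J s ≤ m0 := fun s =>
    sup_le ((pastLosses_le_allLosses t).trans hℓ.allLosses_le) (hJ.pastArms_le s)
  induction s, hs using Nat.le_induction with
  | base => simpa [pastArms] using hY
  | succ s hs ih =>
    have ih := ih (Nat.le_of_succ_le hst)
    refine (ae_eq_condExp_of_forall_setIntegral_eq (hle (s + 1)) hYi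
      (fun _ _ _ => integrableOn_zero) (fun S hS _ => ?_)
      aestronglyMeasurable_zero).symm
    simp only [integral_zero]
    have hSm0 := hle (s + 1) S hS
    rw [pastArms_succ hs, ← sup_assoc] at hS
    -- On each event $J_s=j$ the set $S$ agrees with a set from the smaller history. Averaging over
    -- $J_s$ then replaces its indicator by adapted weights, to which the induction hypothesis
    -- applies.
    choose A hA hAS using fun j => exists_measurableSet_inter_eq hS j
    have h1 : ∫ ω in S, Y ω ∂μ = ∫ ω, (fun ω j => (A j).indicator Y ω) ω (J s ω) ∂μ := by
      rw [← integral_indicator hSm0]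
      refine integral_congr_ae (Filter.Eventually.of_forall fun ω => ?_)
      simp only [Set.indicator_apply, hAS (J s ω) ω rfl]
    have hAle : pastLosses ℓ t ⊔ pastArms J s ≤ allLosses ℓ ⊔ pastArms J s :=
      sup_le_sup_right (pastLosses_le_allLosses t) _
    have hind : ∀ ω j, |(A j).indicator Y ω| ≤ M := fun ω j => by
      rw [Set.indicator_apply]
      split_ifs
      · exact hM ω
      · rw [abs_zero]; exact (abs_nonneg _).trans (hM ω)
    have hterm : ∀ j, ∀ ω, p s ω j * (A j).indicator Y ω
        = (A j).indicator (fun ω => p s ω j) ω * Y ω := fun j ω => by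
      simp only [Set.indicator_apply]
      split_ifs <;> simp
    have hpm : ∀ j, Measurable[pastLosses ℓ t ⊔ pastArms J s]
        ((A j).indicator (fun ω => p s ω j)) := fun j =>
      (measurable_weights_past hη hJ.weights hs (Nat.le_of_succ_le hst) j).indicator (hA j)
    have hpb : ∀ j ω, |(A j).indicator (fun ω => p s ω j) ω| ≤ 1 := fun j ω => by
      rw [Set.indicator_apply]
      split_ifs
      · exact weights_le_one hJ.weights hs ω j
      · simp
    rw [h1, hJ.integral_arm hη hℓ hs (M := M)
      (fun j => (hYm.mono le_sup_left le_rfl).indicator (hAle _ (hA j))) hind]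
    simp only [hterm]
    rw [integral_finsetSum]
    · exact (Finset.sum_eq_zero fun j _ =>
        integral_mul_eq_zero_of_condExp (hle s) hYi ih (hpm j) (hpb j)).symm
    · intro j _
      exact hYi.bdd_mul ((hpm j).mono (hle s) le_rfl).aestronglyMeasurable
        (Filter.Eventually.of_forall (hpb j))

end Sampling

/-! ### From path-wise bounds to expected regret -/

section Regret

variable {Ω : Type*} [m0 : MeasurableSpace Ω] {μ : Measure Ω} [IsProbabilityMeasure μ] {K : ℕ}
  {B : ℝ} {η : ℕ → ℝ} {ℓ : ℕ → Ω → Fin K → ℝ} {J : ℕ → Ω → Fin K}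
  {p : ℕ → Ω → Fin K → ℝ} {D : Fin K → Fin K → ℝ}

lemma IsLossSequence.abs_le (hℓ : IsLossSequence B ℓ) {t : ℕ} (ht : 1 ≤ t) (ω : Ω) (i : Fin K) :
    |ℓ t ω i| ≤ B := by
  rw [abs_of_nonneg (hℓ.mem_Icc t ht ω i).1]
  exact (hℓ.mem_Icc t ht ω i).2

lemma IsLossSequence.integrable (hℓ : IsLossSequence B ℓ) {t : ℕ} (ht : 1 ≤ t) (i : Fin K) :
    Integrable (fun ω => ℓ t ω i) μ :=
  integrable_of_abs_le ((measurable_pi_apply i).comp (hℓ.measurable t ht))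
    (hℓ.abs_le ht · i)

variable [NeZero K]

lemma IsTsallisINF.integrable_weights (hη : ∀ t, 1 ≤ t → 0 < η t)
    (hℓ : IsLossSequence B ℓ) (hJ : IsTsallisINF μ η ℓ J p) {t : ℕ} (ht : 1 ≤ t) (i : Fin K) :
    Integrable (fun ω => p t ω i) μ :=
  integrable_of_abs_le (hJ.measurable_weights hη hℓ ht i) (weights_le_one hJ.weights ht · i)

lemma IsTsallisINF.integrable_sqrt_weights (hη : ∀ t, 1 ≤ t → 0 < η t)
    (hℓ : IsLossSequence B ℓ) (hJ : IsTsallisINF μ η ℓ J p) {t : ℕ} (ht : 1 ≤ t) (i : Fin K) :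
    Integrable (fun ω => √(p t ω i)) μ :=
  integrable_of_abs_le (hJ.measurable_weights hη hℓ ht i).sqrt (M := 1) fun ω => by
    rw [abs_of_nonneg (Real.sqrt_nonneg _)]
    exact Real.sqrt_le_one.2 (le_one_of_mem_stdSimplex (hJ.weights t ht ω).1 i)

lemma IsTsallisINF.integral_loss_sub (hη : ∀ t, 1 ≤ t → 0 < η t)
    (hℓ : IsLossSequence B ℓ) (hJ : IsTsallisINF μ η ℓ J p) (hD : IsStochConstrained μ B ℓ D)
    {t : ℕ} (ht : 1 ≤ t) (a : Fin K) :
    ∫ ω, ℓ t ω (J t ω) ∂μ - ∫ ω, ℓ t ω a ∂μ = ∑ i, B * D i a * ∫ ω, p t ω i ∂μ := by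
  have hm : ∀ i, Measurable[allLosses ℓ ⊔ pastArms J t] (fun ω => ℓ t ω i) := fun i =>
    measurable_allLosses ht i
  have hm' : ∀ i, Measurable[allLosses ℓ] (fun ω => ℓ t ω i) := fun i =>
    (measurable_allLosses (J := J) (t := 0) ht i).mono (by simp [pastArms]) le_rfl
  have h1 : ∫ ω, ℓ t ω (J t ω) ∂μ - ∫ ω, ℓ t ω a ∂μ
      = ∫ ω, ∑ i, p t ω i * (ℓ t ω i - ℓ t ω a) ∂μ := by
    rw [← integral_sub (hJ.integrable_arm hℓ ht hm (fun ω i => hℓ.abs_le ht ω i))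
      (hℓ.integrable ht a)]
    exact hJ.integral_arm hη hℓ ht (f := fun ω i => ℓ t ω i - ℓ t ω a) (M := B + B)
      (fun i => (hm i).sub (hm a))
      (fun ω i => (abs_sub _ _).trans (add_le_add (hℓ.abs_le ht ω i) (hℓ.abs_le ht ω a)))
  have hpast : pastLosses ℓ t ⊔ pastArms J t ≤ m0 :=
    sup_le ((pastLosses_le_allLosses t).trans hℓ.allLosses_le) (hJ.pastArms_le t)
  have hdi : ∀ i, Integrable (fun ω => ℓ t ω i - ℓ t ω a) μ := fun i =>
    (hℓ.integrable ht i).sub (hℓ.integrable ht a)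
  have hpi : ∀ {f : Ω → ℝ} i, Integrable f μ → Integrable (fun ω => p t ω i * f ω) μ :=
    fun i hf => hf.bdd_mul (hJ.measurable_weights hη hℓ ht i).aestronglyMeasurable
      (Filter.Eventually.of_forall (weights_le_one hJ.weights ht · i))
  rw [h1, integral_finsetSum _ fun i _ => hpi i (hdi i)]
  refine Finset.sum_congr rfl fun i _ => ?_
  -- The centred loss difference has mean zero given past losses and arms, hence is orthogonal to
  -- the adapted weight $p_{t,i}$.
  set Y : Ω → ℝ := fun ω => ℓ t ω i - ℓ t ω a - B * D i a with hY
  have hYi : Integrable Y μ := (hdi i).sub (integrable_const _)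
  have hYc : μ[Y | pastLosses ℓ t] =ᵐ[μ] 0 := by
    have hle := (pastLosses_le_allLosses t).trans hℓ.allLosses_le
    have h2 := condExp_sub (hdi i) (integrable_const (μ := μ) (B * D i a)) (pastLosses ℓ t)
    rw [condExp_const hle] at h2
    filter_upwards [h2, hD t ht i a] with ω h3 h4
    refine h3.trans ?_
    simp [h4]
  have h2 : μ[Y | pastLosses ℓ t ⊔ pastArms J t] =ᵐ[μ] 0 :=
    hJ.condExp_pastArms hη hℓ (M := B + B + |B * D i a|)
      (((hm' i).sub (hm' a)).sub measurable_const)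
      (fun ω => (abs_sub _ _).trans (add_le_add ((abs_sub _ _).trans
        (add_le_add (hℓ.abs_le ht ω i) (hℓ.abs_le ht ω a))) le_rfl)) hYc ht le_rfl
  have h3 := integral_mul_eq_zero_of_condExp hpast hYi h2
    (measurable_weights_past hη hJ.weights ht le_rfl i) (weights_le_one hJ.weights ht · i)
  have h4 : ∀ ω, p t ω i * (ℓ t ω i - ℓ t ω a) = p t ω i * Y ω + B * D i a * p t ω i :=
    fun ω => by rw [hY]; ring
  simp only [h4]
  rw [integral_add (hpi i hYi) ((hJ.integrable_weights hη hℓ ht i).const_mul _), h3, zero_add,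
    integral_const_mul]

lemma learningRate_pos (hB : 0 < B) (t : ℕ) (ht : 1 ≤ t) : 0 < 2 / (B * √(t : ℝ)) := by
  have : (0 : ℝ) < √(t : ℝ) := Real.sqrt_pos.2 (by exact_mod_cast ht)
  positivity

/-- Regret bound from stability terms `g t ω j`, which may depend on the arm `j` that is played. -/
lemma IsTsallisINF.regret_le (hB : 0 < B) (hℓ : IsLossSequence B ℓ)
    (hJ : IsTsallisINF μ (fun t => 2 / (B * √(t : ℝ))) ℓ J p) (g : ℕ → Ω → Fin K → ℝ)
    (hgm : ∀ t, 1 ≤ t → ∀ j, Measurable[allLosses ℓ ⊔ pastArms J t] (fun ω => g t ω j))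
    (hgb : ∀ t, 1 ≤ t → ∃ M, ∀ ω j, |g t ω j| ≤ M)
    (hg : ∀ t, 1 ≤ t → ∀ ω j, ∀ w ∈ stdSimplex ℝ (Fin K),
      (p t ω j - w j) * (ℓ t ω j / p t ω j)
        ≤ tsallisDiv w (p t ω) / (2 / (B * √(t : ℝ))) + g t ω j)
    (T : ℕ) (u : Fin K) :
    ∑ t ∈ Finset.Icc 1 T, (∫ ω, ℓ t ω (J t ω) ∂μ - ∫ ω, ℓ t ω u ∂μ)
      ≤ ∑ t ∈ Finset.Icc 1 T, (∫ ω, ∑ j, p t ω j * g t ω j ∂μ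
        + 2 * B * (√(t : ℝ) - √((t - 1 : ℕ) : ℝ)) * (∑ i, ∫ ω, √(p t ω i) ∂μ - 1)) := by
  have hη := learningRate_pos hB
  have hpos : ∀ t, 1 ≤ t → ∀ ω i, 0 < p t ω i := fun t ht ω i =>
    (hJ.weights t ht ω).pos (hη t ht) i
  have hpath : ∀ ω, ∑ t ∈ Finset.Icc 1 T, (ℓ t ω (J t ω) - lossEstimate ℓ J p t ω u)
      ≤ ∑ t ∈ Finset.Icc 1 T, (g t ω (J t ω)
        + 2 * B * (√(t : ℝ) - √((t - 1 : ℕ) : ℝ)) * (∑ i, √(p t ω i) - 1)) := by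
    intro ω
    have hsum : ∀ t (f : Fin K → ℝ), ∑ i, f i * lossEstimate ℓ J p t ω i
        = f (J t ω) * (ℓ t ω (J t ω) / p t ω (J t ω)) := by
      intro t f
      simp [lossEstimate]
    have h := ftrl_regret_le (β := fun t => 2 * B * √(t : ℝ)) (s := fun t => g t ω (J t ω))
      (l := fun t => lossEstimate ℓ J p t ω) (p := fun t => p t ω) hη (by simp)
      (fun t ht => by
        have : (0 : ℝ) < √(t : ℝ) := Real.sqrt_pos.2 (by exact_mod_cast ht)
        field_simp
        norm_num)
      (cumLossEstimate_one (ℓ := ℓ) (J := J) (p := p) ω)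
      (fun t ht => cumLossEstimate_succ ht ω) (fun t ht => hJ.weights t ht ω)
      (fun t ht w hw => by
        rw [hsum t (fun i => p t ω i - w i)]
        exact hg t ht ω _ w hw) T u
    refine le_trans (le_of_eq ?_) (h.trans (le_of_eq ?_))
    · refine Finset.sum_congr rfl fun t ht => ?_
      rw [hsum t (p t ω), mul_div_cancel₀ _ (hpos t (Finset.mem_Icc.1 ht).1 ω _).ne']
    · exact Finset.sum_congr rfl fun t _ => by ring
  have hlm : ∀ t, 1 ≤ t → ∀ i, Measurable[allLosses ℓ ⊔ pastArms J t] (fun ω => ℓ t ω i) :=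
    fun t ht i => measurable_allLosses ht i
  have hli : ∀ t, 1 ≤ t → Integrable (fun ω => ℓ t ω (J t ω)) μ := fun t ht =>
    hJ.integrable_arm hℓ ht (hlm t ht) (fun ω i => hℓ.abs_le ht ω i)
  -- The loss estimate of $u$ as a function of the played arm; integrating out that arm cancels
  -- $p_{t,u}$, which is unbiasedness.
  let e : ℕ → Ω → Fin K → ℝ := fun t ω j => if j = u then ℓ t ω u / p t ω u else 0
  have hem : ∀ t, 1 ≤ t → ∀ j, Measurable[allLosses ℓ ⊔ pastArms J t] (fun ω => e t ω j) := by
    intro t ht j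
    have hpm : Measurable[allLosses ℓ ⊔ pastArms J t] (fun ω => p t ω u) :=
      (measurable_weights_past hη hJ.weights ht le_rfl u).mono
        (sup_le_sup_right (pastLosses_le_allLosses t) _) le_rfl
    by_cases hj : j = u
    · simp only [e, if_pos hj]
      exact (hlm t ht u).div hpm
    · simpa only [e, if_neg hj] using measurable_const
  have heb : ∀ t, 1 ≤ t → ∃ M, ∀ ω j, |e t ω j| ≤ M := by
    intro t ht
    obtain ⟨M, hM⟩ := exists_inv_weights_le hη hℓ.mem_Icc hJ.weights ht
    refine ⟨B * |M|, fun ω j => ?_⟩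
    have hu := hpos t ht ω u
    have h1 := (hM ω u).trans (le_abs_self M)
    by_cases hj : j = u
    · simp only [e, if_pos hj]
      rw [div_eq_mul_one_div, abs_mul, abs_of_pos (one_div_pos.2 hu)]
      exact mul_le_mul (hℓ.abs_le ht ω u) h1 (by positivity) hB.le
    · simp only [e, if_neg hj, abs_zero]
      positivity
  have hee : ∀ t, (fun ω => lossEstimate ℓ J p t ω u) = fun ω => e t ω (J t ω) := fun t => rfl
  have hei : ∀ t, 1 ≤ t → Integrable (fun ω => lossEstimate ℓ J p t ω u) μ := fun t ht => by
    obtain ⟨M, hM⟩ := heb t ht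
    exact hJ.integrable_arm hℓ ht (hem t ht) hM
  have hev : ∀ t, 1 ≤ t → ∫ ω, lossEstimate ℓ J p t ω u ∂μ = ∫ ω, ℓ t ω u ∂μ := fun t ht => by
    obtain ⟨M, hM⟩ := heb t ht
    rw [hee, hJ.integral_arm hη hℓ ht (hem t ht) hM]
    refine integral_congr_ae (Filter.Eventually.of_forall fun ω => ?_)
    simp only [e, mul_ite, mul_zero, Finset.sum_ite_eq', Finset.mem_univ, if_true]
    exact mul_div_cancel₀ _ (hpos t ht ω u).ne'
  have hgi : ∀ t, 1 ≤ t → Integrable (fun ω => g t ω (J t ω)) μ := fun t ht => by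
    obtain ⟨M, hM⟩ := hgb t ht
    exact hJ.integrable_arm hℓ ht (hgm t ht) hM
  have hgv : ∀ t, 1 ≤ t → ∫ ω, g t ω (J t ω) ∂μ = ∫ ω, ∑ j, p t ω j * g t ω j ∂μ :=
    fun t ht => by
      obtain ⟨M, hM⟩ := hgb t ht
      exact hJ.integral_arm hη hℓ ht (hgm t ht) hM
  have hsi : ∀ t, 1 ≤ t → Integrable (fun ω => ∑ i, √(p t ω i)) μ := fun t ht =>
    integrable_finsetSum _ fun i _ => hJ.integrable_sqrt_weights hη hℓ ht i
  have hpi : ∀ t : ℕ, 1 ≤ t → Integrable (fun ω => 2 * B * (√(t : ℝ) - √((t - 1 : ℕ) : ℝ))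
      * (∑ i, √(p t ω i) - 1)) μ := fun t ht =>
    ((hsi t ht).sub (integrable_const 1)).const_mul _
  have h1 : ∀ t ∈ Finset.Icc 1 T, 1 ≤ t := fun t ht => (Finset.mem_Icc.1 ht).1
  have hlei : ∀ t ∈ Finset.Icc 1 T,
      Integrable (fun ω => ℓ t ω (J t ω) - lossEstimate ℓ J p t ω u) μ :=
    fun t ht => (hli t (h1 t ht)).sub (hei t (h1 t ht))
  have hgpi : ∀ t ∈ Finset.Icc 1 T, Integrable (fun ω => g t ω (J t ω)
      + 2 * B * (√(t : ℝ) - √((t - 1 : ℕ) : ℝ)) * (∑ i, √(p t ω i) - 1)) μ :=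
    fun t ht => (hgi t (h1 t ht)).add (hpi t (h1 t ht))
  have hmono := integral_mono (integrable_finsetSum _ hlei) (integrable_finsetSum _ hgpi) hpath
  rw [integral_finsetSum _ hlei, integral_finsetSum _ hgpi] at hmono
  refine le_trans (le_of_eq ?_) (hmono.trans (le_of_eq ?_))
  · refine Finset.sum_congr rfl fun t ht => ?_
    rw [integral_sub (hli t (h1 t ht)) (hei t (h1 t ht)), hev t (h1 t ht)]
  · refine Finset.sum_congr rfl fun t ht => ?_
    rw [integral_add (hgi t (h1 t ht)) (hpi t (h1 t ht)), hgv t (h1 t ht), integral_const_mul,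
      integral_sub (hsi t (h1 t ht)) (integrable_const 1),
      integral_finsetSum _ fun i _ => hJ.integrable_sqrt_weights hη hℓ (h1 t ht) i]
    simp

end Regret

/-! ### Adversarial and self-bounding regret bounds -/

section Main

variable {Ω : Type*} [m0 : MeasurableSpace Ω] {μ : Measure Ω} [IsProbabilityMeasure μ] {K : ℕ}
  {B : ℝ} {ℓ : ℕ → Ω → Fin K → ℝ} {J : ℕ → Ω → Fin K}
  {p : ℕ → Ω → Fin K → ℝ} {D : Fin K → Fin K → ℝ}

lemma IsStochConstrained.integral_sub_eq (hℓ : IsLossSequence B ℓ)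
    (hD : IsStochConstrained μ B ℓ D) {t : ℕ} (ht : 1 ≤ t) (i j : Fin K) :
    ∫ ω, ℓ t ω i ∂μ - ∫ ω, ℓ t ω j ∂μ = B * D i j := by
  have hle := (pastLosses_le_allLosses (ℓ := ℓ) t).trans hℓ.allLosses_le
  rw [← integral_sub (hℓ.integrable ht i) (hℓ.integrable ht j), ← integral_condExp hle,
    integral_congr_ae (hD t ht i j)]
  simp

lemma IsTsallisINF.pseudoRegret_eq (hℓ : IsLossSequence B ℓ)
    {η : ℕ → ℝ} (hJ : IsTsallisINF μ η ℓ J p) (T : ℕ) :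
    pseudoRegret μ ℓ J T = ∑ t ∈ Finset.Icc 1 T, ∫ ω, ℓ t ω (J t ω) ∂μ
      - ⨅ i, ∑ t ∈ Finset.Icc 1 T, ∫ ω, ℓ t ω i ∂μ := by
  have h1 : ∀ t ∈ Finset.Icc 1 T, 1 ≤ t := fun t ht => (Finset.mem_Icc.1 ht).1
  rw [pseudoRegret, integral_finsetSum _ fun t ht => hJ.integrable_arm hℓ (h1 t ht)
    (fun i => measurable_allLosses (h1 t ht) i) (fun ω i => hℓ.abs_le (h1 t ht) ω i)]
  congr 1
  exact iInf_congr fun i => integral_finsetSum _ fun t ht => hℓ.integrable (h1 t ht) i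

variable [NeZero K]

/-- Differences of expectations are additive, which makes `D` additive after division by $B$. -/
lemma IsStochConstrained.eq_gap (hB : 0 < B) (hℓ : IsLossSequence B ℓ)
    (hD : IsStochConstrained μ B ℓ D) {a : Fin K} (ha : gap D a = 0) (i : Fin K) :
    D i a = gap D i := by
  have h1 := hD.integral_sub_eq hℓ le_rfl i a
  have h2 := hD.integral_sub_eq hℓ le_rfl i 0
  have h3 := hD.integral_sub_eq hℓ le_rfl a 0
  have h4 : B * D i a = B * (D i 0 - D a 0) := by rw [mul_sub]; linarith
  have h5 := mul_left_cancel₀ hB.ne' h4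
  unfold gap at ha ⊢
  linarith

/-- The regret bound in an adversarial environment. -/
lemma IsTsallisINF.regret_adversarial (hB : 0 < B) (hℓ : IsLossSequence B ℓ)
    (hJ : IsTsallisINF μ (fun t => 2 / (B * √(t : ℝ))) ℓ J p) (T : ℕ) (u : Fin K) :
    ∑ t ∈ Finset.Icc 1 T, (∫ ω, ℓ t ω (J t ω) ∂μ - ∫ ω, ℓ t ω u ∂μ)
      ≤ 4 * B * √((K : ℝ) * (T : ℝ)) := by
  have hη := learningRate_pos hB
  have hpos : ∀ t, 1 ≤ t → ∀ ω i, 0 < p t ω i := fun t ht ω i =>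
    (hJ.weights t ht ω).pos (hη t ht) i
  have h := hJ.regret_le hB hℓ (fun t ω j => B / √(t : ℝ) * (√(p t ω j) / p t ω j))
    (fun t ht j => (hJ.measurable_sqrt_div_weights hη ht j j).const_mul _)
    (fun t ht => by
      obtain ⟨M, hM⟩ := hJ.exists_sqrt_div_weights_le hη hℓ ht
      refine ⟨B / √(t : ℝ) * M, fun ω j => ?_⟩
      rw [abs_mul, abs_of_nonneg (by positivity : 0 ≤ B / √(t : ℝ))]
      exact mul_le_mul_of_nonneg_left (hM ω j j) (by positivity))
    (fun t ht ω j w hw => tsallis_stability_le hB ht (hpos t ht ω) hw (hℓ.mem_Icc t ht ω j) j) T u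
  refine h.trans ?_
  have hterm : ∀ t ∈ Finset.Icc 1 T,
      ∫ ω, ∑ j, p t ω j * (B / √(t : ℝ) * (√(p t ω j) / p t ω j)) ∂μ
        + 2 * B * (√(t : ℝ) - √((t - 1 : ℕ) : ℝ)) * (∑ i, ∫ ω, √(p t ω i) ∂μ - 1)
      ≤ B * √(K : ℝ) * (1 / √(t : ℝ))
        + 2 * B * √(K : ℝ) * (√(t : ℝ) - √((t - 1 : ℕ) : ℝ)) := by
    intro t ht
    have ht := (Finset.mem_Icc.1 ht).1
    have hi := fun i (_ : i ∈ Finset.univ) => hJ.integrable_sqrt_weights hη hℓ ht i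
    have h1 : ∀ ω, ∑ j, p t ω j * (B / √(t : ℝ) * (√(p t ω j) / p t ω j))
        = B / √(t : ℝ) * ∑ j, √(p t ω j) := by
      intro ω
      rw [Finset.mul_sum]
      refine Finset.sum_congr rfl fun j _ => ?_
      have := hpos t ht ω j
      field_simp
    have h2 : ∑ i, ∫ ω, √(p t ω i) ∂μ ≤ √(K : ℝ) := by
      rw [← integral_finsetSum _ hi]
      have := integral_mono (μ := μ) (integrable_finsetSum _ hi) (integrable_const (√(K : ℝ)))
        (fun ω => sum_sqrt_le (hJ.weights t ht ω).1)
      simpa using this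
    simp only [h1]
    rw [integral_const_mul, integral_finsetSum _ hi]
    have h3 : 0 ≤ √(t : ℝ) - √((t - 1 : ℕ) : ℝ) :=
      sub_nonneg.2 (Real.sqrt_le_sqrt (by exact_mod_cast Nat.sub_le t 1))
    have h4 : B / √(t : ℝ) * ∑ i, ∫ ω, √(p t ω i) ∂μ ≤ B / √(t : ℝ) * √(K : ℝ) := by gcongr
    have h5 : 2 * B * (√(t : ℝ) - √((t - 1 : ℕ) : ℝ)) * (∑ i, ∫ ω, √(p t ω i) ∂μ - 1)
        ≤ 2 * B * (√(t : ℝ) - √((t - 1 : ℕ) : ℝ)) * √(K : ℝ) := by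
      gcongr
      linarith
    refine (add_le_add h4 h5).trans (le_of_eq ?_)
    ring
  refine (Finset.sum_le_sum hterm).trans ?_
  have htel : ∑ t ∈ Finset.Icc 1 T, (√(t : ℝ) - √((t - 1 : ℕ) : ℝ)) = √(T : ℝ) := by
    clear h hterm
    induction T with
    | zero => simp
    | succ T ih =>
      rw [Finset.sum_Icc_succ_top (Nat.le_add_left 1 T), ih, Nat.add_sub_cancel]
      ring
  rw [Finset.sum_add_distrib, ← Finset.mul_sum, ← Finset.mul_sum, htel,
    Real.sqrt_mul (Nat.cast_nonneg K)]
  have := mul_le_mul_of_nonneg_left (sum_inv_sqrt_le T) (by positivity : 0 ≤ B * √(K : ℝ))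
  linarith

/-- A bound on the regret with respect to any fixed arm `a` in terms of the sampling probabilities
of the other arms. -/
lemma IsTsallisINF.regret_le_sum_ne (hB : 0 < B) (hℓ : IsLossSequence B ℓ)
    (hJ : IsTsallisINF μ (fun t => 2 / (B * √(t : ℝ))) ℓ J p) (T : ℕ) (a : Fin K) :
    ∑ t ∈ Finset.Icc 1 T, (∫ ω, ℓ t ω (J t ω) ∂μ - ∫ ω, ℓ t ω a ∂μ)
      ≤ ∑ t ∈ Finset.Icc 1 T, 9 / 2 * (B / √(t : ℝ))
        * ∑ i ∈ Finset.univ.filter (fun i => i ≠ a), ∫ ω, √(p t ω i) ∂μ := by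
  have hη := learningRate_pos hB
  have hpos : ∀ t, 1 ≤ t → ∀ ω i, 0 < p t ω i := fun t ht ω i =>
    (hJ.weights t ht ω).pos (hη t ht) i
  let s : Finset (Fin K) := Finset.univ.filter (fun i => i ≠ a)
  let g : ℕ → Ω → Fin K → ℝ := fun t ω j =>
    if j = a then 3 / 2 * (B / √(t : ℝ)) * ∑ i ∈ s, √(p t ω i) / p t ω a
    else B / √(t : ℝ) * (√(p t ω j) / p t ω j)
  have h := hJ.regret_le hB hℓ g
    (fun t ht j => by
      by_cases hj : j = a
      · simp only [g, if_pos hj]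
        exact (Finset.measurable_sum _ fun i _ =>
          hJ.measurable_sqrt_div_weights hη ht i a).const_mul _
      · simp only [g, if_neg hj]
        exact (hJ.measurable_sqrt_div_weights hη ht j j).const_mul _)
    (fun t ht => by
      obtain ⟨M, hM⟩ := hJ.exists_sqrt_div_weights_le hη hℓ ht
      refine ⟨max (3 / 2 * (B / √(t : ℝ)) * ∑ i ∈ s, M) (B / √(t : ℝ) * M), fun ω j => ?_⟩
      by_cases hj : j = a
      · simp only [g, if_pos hj]
        refine le_max_of_le_left ?_
        rw [abs_mul, abs_of_nonneg (by positivity : 0 ≤ 3 / 2 * (B / √(t : ℝ)))]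
        exact mul_le_mul_of_nonneg_left ((Finset.abs_sum_le_sum_abs _ _).trans
          (Finset.sum_le_sum fun i _ => hM ω i a)) (by positivity)
      · simp only [g, if_neg hj]
        refine le_max_of_le_right ?_
        rw [abs_mul, abs_of_nonneg (by positivity : 0 ≤ B / √(t : ℝ))]
        exact mul_le_mul_of_nonneg_left (hM ω j j) (by positivity))
    (fun t ht ω j w hw => by
      by_cases hj : j = a
      · subst hj
        simp only [g, if_true, ← Finset.sum_div]
        refine tsallis_stability_le_sum_ne hB ht (hJ.weights t ht ω).1 (hpos t ht ω) ?_ hw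
          (hℓ.mem_Icc t ht ω j) j
        intro h1 i k
        subst h1
        have h2 := hJ.weights 1 le_rfl ω
        rw [cumLossEstimate_one] at h2
        rw [h2.eq_uniform (hη 1 le_rfl), h2.eq_uniform (hη 1 le_rfl)]
      · simp only [g, if_neg hj]
        exact tsallis_stability_le hB ht (hpos t ht ω) hw (hℓ.mem_Icc t ht ω j) j) T a
  refine h.trans (Finset.sum_le_sum fun t ht => ?_)
  have ht := (Finset.mem_Icc.1 ht).1
  have ht0 : (0 : ℝ) < √(t : ℝ) := Real.sqrt_pos.2 (by exact_mod_cast ht)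
  have hi := fun i (_ : i ∈ s) => hJ.integrable_sqrt_weights hη hℓ ht i
  -- The factor $5/2$ is $1$ from playing the other arms plus $3/2$ from playing $a$; the penalty
  -- adds $2$, for a total of $9/2$.
  have h1 : ∀ ω, ∑ j, p t ω j * g t ω j = 5 / 2 * (B / √(t : ℝ)) * ∑ j ∈ s, √(p t ω j) := by
    intro ω
    have e1 := sum_filter_ne (fun j => p t ω j * g t ω j) a
    have e2 : ∑ j ∈ s, p t ω j * g t ω j = B / √(t : ℝ) * ∑ j ∈ s, √(p t ω j) := by
      rw [Finset.mul_sum]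
      refine Finset.sum_congr rfl fun j hj => ?_
      have := hpos t ht ω j
      simp only [g, if_neg (Finset.mem_filter.1 hj).2]
      field_simp
    have e3 : p t ω a * g t ω a = 3 / 2 * (B / √(t : ℝ)) * ∑ j ∈ s, √(p t ω j) := by
      have := hpos t ht ω a
      simp only [g, if_true, ← Finset.sum_div]
      field_simp
    rw [e2] at e1
    linarith
  have h2 : ∑ i, ∫ ω, √(p t ω i) ∂μ - 1 ≤ ∑ i ∈ s, ∫ ω, √(p t ω i) ∂μ := by
    have e := sum_filter_ne (fun i => ∫ ω, √(p t ω i) ∂μ) a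
    have h3 : ∫ ω, √(p t ω a) ∂μ ≤ 1 := by
      have := integral_mono (μ := μ) (hJ.integrable_sqrt_weights hη hℓ ht a) (integrable_const 1)
        (fun ω => Real.sqrt_le_one.2 (le_one_of_mem_stdSimplex (hJ.weights t ht ω).1 a))
      simpa using this
    linarith
  have h3 : 0 ≤ √(t : ℝ) - √((t - 1 : ℕ) : ℝ) :=
    sub_nonneg.2 (Real.sqrt_le_sqrt (by exact_mod_cast Nat.sub_le t 1))
  have h4 : 0 ≤ ∑ i ∈ s, ∫ ω, √(p t ω i) ∂μ :=
    Finset.sum_nonneg fun i _ => integral_nonneg fun ω => Real.sqrt_nonneg _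
  simp only [h1]
  rw [integral_const_mul, integral_finsetSum _ hi]
  have h5 : 2 * B * (√(t : ℝ) - √((t - 1 : ℕ) : ℝ)) * (∑ i, ∫ ω, √(p t ω i) ∂μ - 1)
      ≤ 2 * B * (1 / √(t : ℝ)) * ∑ i ∈ s, ∫ ω, √(p t ω i) ∂μ :=
    (mul_le_mul_of_nonneg_left h2 (by positivity)).trans (mul_le_mul_of_nonneg_right
      (mul_le_mul_of_nonneg_left (sqrt_sub_sqrt_pred_le ht) (by positivity)) h4)
  refine (add_le_add le_rfl h5).trans (le_of_eq ?_)
  ring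

/-- Completing the square in $\sqrt x$; the coefficient $9$ is twice the $9/2$ of the regret bound.
-/
lemma self_bounding {d x t : ℝ} (hd : 0 < d) (ht : 0 < t) (hx : 0 ≤ x) :
    9 / √t * √x ≤ d * x + 81 / 4 * (1 / t * (1 / d)) := by
  obtain ⟨a, ha, rfl⟩ : ∃ a, 0 < a ∧ t = a ^ 2 := ⟨√t, Real.sqrt_pos.2 ht, (Real.sq_sqrt ht.le).symm⟩
  obtain ⟨b, hb, rfl⟩ : ∃ b, 0 ≤ b ∧ x = b ^ 2 := ⟨√x, Real.sqrt_nonneg x, (Real.sq_sqrt hx).symm⟩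
  rw [Real.sqrt_sq ha.le, Real.sqrt_sq hb]
  have e : d * b ^ 2 + 81 / 4 * (1 / a ^ 2 * (1 / d)) - 9 / a * b
      = (d * b - 9 / (2 * a)) ^ 2 / d := by
    field_simp
    ring
  have : 0 ≤ (d * b - 9 / (2 * a)) ^ 2 / d := by positivity
  linarith

/-- The regret bound in the stochastically constrained adversarial regime. -/
lemma IsTsallisINF.regret_stochConstrained (hB : 0 < B) (hℓ : IsLossSequence B ℓ)
    (hJ : IsTsallisINF μ (fun t => 2 / (B * √(t : ℝ))) ℓ J p) (hD : IsStochConstrained μ B ℓ D)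
    {a : Fin K} (ha : IsUniqueBestArm D a) (T : ℕ) :
    ∑ t ∈ Finset.Icc 1 T, (∫ ω, ℓ t ω (J t ω) ∂μ - ∫ ω, ℓ t ω a ∂μ)
      ≤ 81 / 4 * B * (Real.log (T : ℝ) + 1)
          * ∑ i ∈ Finset.univ.filter (fun i => i ≠ a), 1 / gap D i := by
  have hη := learningRate_pos hB
  set R := ∑ t ∈ Finset.Icc 1 T, (∫ ω, ℓ t ω (J t ω) ∂μ - ∫ ω, ℓ t ω a ∂μ) with hR
  set s : Finset (Fin K) := Finset.univ.filter (fun i => i ≠ a) with hs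
  have h1 : R = ∑ t ∈ Finset.Icc 1 T, ∑ i ∈ s, B * (gap D i * ∫ ω, p t ω i ∂μ) := by
    refine Finset.sum_congr rfl fun t ht => ?_
    rw [hJ.integral_loss_sub hη hℓ hD (Finset.mem_Icc.1 ht).1 a, sum_filter_ne, ha.1]
    simp only [hD.eq_gap hB hℓ ha.1]
    rw [zero_mul, mul_zero, sub_zero]
    exact Finset.sum_congr rfl fun i _ => mul_assoc _ _ _
  have h2 : R ≤ _ := hJ.regret_le_sum_ne hB hℓ T a
  -- Self-bounding: the linear terms $B\Delta_i\mathbb E\,p_{t,i}$ add up to the regret itself, so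
  -- with `h2` one copy of $R$ cancels.
  have h3 : 2 * ∑ t ∈ Finset.Icc 1 T, 9 / 2 * (B / √(t : ℝ)) * ∑ i ∈ s, ∫ ω, √(p t ω i) ∂μ
      ≤ R + ∑ t ∈ Finset.Icc 1 T, ∑ i ∈ s, B * (81 / 4 * (1 / (t : ℝ) * (1 / gap D i))) := by
    rw [h1, ← Finset.sum_add_distrib, Finset.mul_sum]
    refine Finset.sum_le_sum fun t ht => ?_
    have ht := (Finset.mem_Icc.1 ht).1
    rw [← Finset.sum_add_distrib, Finset.mul_sum, Finset.mul_sum]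
    refine Finset.sum_le_sum fun i hi => ?_
    have hd := ha.2 i (Finset.mem_filter.1 hi).2
    have hpi := hJ.integrable_weights hη hℓ ht i
    have h4 := integral_mono (μ := μ) ((hJ.integrable_sqrt_weights hη hℓ ht i).const_mul _)
      ((hpi.const_mul _).add (integrable_const _))
      (fun ω => self_bounding hd (by exact_mod_cast ht : (0 : ℝ) < t)
        ((hJ.weights t ht ω).1.1 i))
    simp only [Pi.add_apply] at h4
    rw [integral_const_mul, integral_add (hpi.const_mul _) (integrable_const _),
      integral_const_mul, integral_const, probReal_univ, one_smul] at h4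
    have h5 := mul_le_mul_of_nonneg_left h4 hB.le
    refine le_trans (le_of_eq ?_) (h5.trans (le_of_eq ?_)) <;> ring
  have h6 : ∑ t ∈ Finset.Icc 1 T, ∑ i ∈ s, B * (81 / 4 * (1 / (t : ℝ) * (1 / gap D i)))
      = 81 / 4 * B * (∑ i ∈ s, 1 / gap D i) * ∑ t ∈ Finset.Icc 1 T, 1 / (t : ℝ) := by
    rw [Finset.mul_sum]
    refine Finset.sum_congr rfl fun t _ => ?_
    rw [Finset.mul_sum, Finset.sum_mul]
    exact Finset.sum_congr rfl fun i _ => by ring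
  have h7 : 0 ≤ ∑ i ∈ s, 1 / gap D i := Finset.sum_nonneg fun i hi =>
    (one_div_pos.2 (ha.2 i (Finset.mem_filter.1 hi).2)).le
  have h8 := mul_le_mul_of_nonneg_left (sum_inv_le_log T)
    (by positivity : 0 ≤ 81 / 4 * B * (∑ i ∈ s, 1 / gap D i))
  linarith

end Main

end Bandit

theorem corollary1 {Ω : Type*} [MeasurableSpace Ω] (μ : Measure Ω) [IsProbabilityMeasure μ]
    (K : ℕ) [NeZero K] (B : ℝ) (hB : 0 < B)
    (ℓ : ℕ → Ω → Fin K → ℝ) (hℓ : Bandit.IsLossSequence B ℓ)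
    (J : ℕ → Ω → Fin K) (p : ℕ → Ω → Fin K → ℝ)
    (hJ : Bandit.IsTsallisINF μ (fun t => 2 / (B * √(t : ℝ))) ℓ J p)
    (T : ℕ) (hT : 1 ≤ T) :
    Bandit.pseudoRegret μ ℓ J T ≤ 4 * B * √((K : ℝ) * (T : ℝ)) + 1 ∧
    ∀ (D : Fin K → Fin K → ℝ) (a : Fin K),
      Bandit.IsStochConstrained μ B ℓ D → Bandit.IsUniqueBestArm D a →
        Bandit.pseudoRegret μ ℓ J T
          ≤ 21 * B * (Real.log (T : ℝ) + 1)
              * ∑ i ∈ Finset.univ.filter (fun i => i ≠ a), 1 / Bandit.gap D i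
            + 8 * √B + 2 := by
  rw [hJ.pseudoRegret_eq hℓ T]
  refine ⟨?_, fun D a hD ha => ?_⟩
  · obtain ⟨u, hu⟩ := exists_eq_ciInf_of_finite
      (f := fun i => ∑ t ∈ Finset.Icc 1 T, ∫ ω, ℓ t ω i ∂μ)
    have h := hJ.regret_adversarial hB hℓ T u
    rw [Finset.sum_sub_distrib] at h
    linarith
  · have h := hJ.regret_stochConstrained hB hℓ hD ha T
    rw [Finset.sum_sub_distrib] at h
    have hpos : ∀ i, 0 ≤ Bandit.gap D i := fun i => by
      by_cases hi : i = a
      · rw [hi, ha.1]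
      · exact (ha.2 i hi).le
    -- Nonnegative gaps make $a$ optimal in every round, so regret against $a$ controls the
    -- pseudo-regret.
    have h1 : ∑ t ∈ Finset.Icc 1 T, ∫ ω, ℓ t ω a ∂μ
        ≤ ⨅ i, ∑ t ∈ Finset.Icc 1 T, ∫ ω, ℓ t ω i ∂μ := by
      refine le_ciInf fun i => Finset.sum_le_sum fun t ht => ?_
      have h2 := hD.integral_sub_eq hℓ (Finset.mem_Icc.1 ht).1 i a
      rw [hD.eq_gap hB hℓ ha.1] at h2
      linarith [mul_nonneg hB.le (hpos i)]
    have h3 : 0 ≤ B * (Real.log (T : ℝ) + 1)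
        * ∑ i ∈ Finset.univ.filter (fun i => i ≠ a), 1 / Bandit.gap D i := by
      have h4 : 0 ≤ Real.log (T : ℝ) := Real.log_natCast_nonneg T
      have h5 : 0 ≤ ∑ i ∈ Finset.univ.filter (fun i => i ≠ a), 1 / Bandit.gap D i :=
        Finset.sum_nonneg fun i _ => one_div_nonneg.2 (hpos i)
      positivity
    -- The constant $81/4$ is rounded up to $21$; the additive terms are slack.
    linarith [Real.sqrt_nonneg B]
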